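/- Let $m>0$ and let $L_0f=-i\,\frac pm\,\partial_q f$ (distributional derivative) be the self-adjoint operator in $L^2(\mathbb R^2)$, with variables $(q,p)$, on its maximal domain $\mathrm{dom}(L_0)=\{f\in L^2(\mathbb R^2):\ p\,\partial_q f\in L^2(\mathbb R^2)\}$, and let $R^0_z=(L_0-z)^{-1}$ for $z\in\mathbb C\setminus\mathbb R$. Let $\gamma:\mathrm{dom}(L_0)\to L^2(\mathbb R,|p|\,dp)$, $(\gamma f)(p)=f(0,p)$, be the trace map, where $f$ is represented by a function that is continuous in $q$ for almost every $p$; $\gamma$ is well defined, linear, and bounded for the graph norm of $L_0$. For $z\in\mathbb C\setminus\mathbb R$ let $$G_z:L^2(\mathbb R,|p|^{-1}dp)\to L^2(\mathbb R^2),\qquad (G_z\phi)(q,p)=g_z(q,p)\,\phi(p),\qquad g_z(q,p)=\theta(qp\,\mathrm{Im}\,z)\,\mathrm{sgn}(\mathrm{Im}\,z)\,\frac{im}{|p|}\,e^{imzq/p},$$ where $\theta$ is the Heaviside function. Then $G_z$ is bounded and $G_z=(\gamma R^0_{\bar z})^*$; here and below, adjoints are taken with respect to the duality of $L^2(\mathbb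 R,|p|^{-1}dp)$ and $L^2(\mathbb R,|p|\,dp)$ given by the scalar product of $L^2(\mathbb R,dp)$. Let $b\in(\mathbb R\setminus\{0\})\cup\{\infty\}$, put $B(p)=bp^2$ if $b\in\mathbb R\setminus\{0\}$ and $B(p)=\infty$ if $b=\infty$ (with $1/\infty=0$), and let $$\Lambda^B_z:L^2(\mathbb R,|p|\,dp)\to L^2(\mathbb R,|p|^{-1}dp),\qquad (\Lambda^B_z\phi)(p)=\frac{\phi(p)}{\frac1{B(p)}-\mathrm{sgn}(\mathrm{Im}\,z)\frac{im}{2|p|}},$$ a bounded operator. Let $(\Pi'f)(p)=\frac12(f(p)-f(-p))$ be the projector on odd functions in $L^2(\mathbb R,|p|\,dp)$ and in $L^2(\mathbb R,|p|^{-1}dp)$. Then $L_0\!\upharpoonright\!\ker\gamma$ is densely defined, closed and symmetric, and it has a self-adjoint extension $L_B$ such that for every $z\in\mathbb C\setminus\mathbb R$ the bounded operator $$R^B_z=R^0_z+G_z\,\Pi'\,\Lambda^B_z\,\Pi'\,G_{\bar z}^*$$ is the resolvent $(L_B-z)^{-1}$. Moreover, for every $z\in\mathbb C\setminus\mathbb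 R$, $$\mathrm{dom}(L_B)=\{f\in L^2(\mathbb R^2):\ f=f_z+G_z\Lambda^B_z\Pi'\gamma f_z,\ f_z\in\mathrm{dom}(L_0)\},$$ and $(L_B-z)f=(L_0-z)f_z$ whenever $f=f_z+G_z\Lambda^B_z\Pi'\gamma f_z$ with $f_z\in\mathrm{dom}(L_0)$. -/

import Mathlib

noncomputable section

namespace DeltaPrime

open MeasureTheory Complex
open scoped ENNReal NNReal ContDiff ComplexConjugate

section WeightedComposition

variable {α β : Type*} [MeasurableSpace α] [MeasurableSpace β]
  {μ : Measure α} {ν : Measure β} {r : β → α} {k : β → ℂ} {C : ℝ≥0}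

/-- The bound under which `f ↦ k · (f ∘ r)` is bounded from `L²(μ)` to `L²(ν)`. -/
def WeightBound (μ : Measure α) (ν : Measure β) (r : β → α) (k : β → ℂ) (C : ℝ≥0) : Prop :=
  (ν.withDensity fun y => ‖k y‖ₑ ^ 2).map r ≤ (C : ℝ≥0∞) • μ

theorem WeightBound.ae_eq (h : WeightBound μ ν r k C) (hr : Measurable r) (hk : Measurable k)
    {f g : α → ℂ} (hfg : f =ᵐ[μ] g) :
    (fun y => k y * f (r y)) =ᵐ[ν] fun y => k y * g (r y) := by
  have h1 : f =ᵐ[(ν.withDensity fun y => ‖k y‖ₑ ^ 2).map r] g :=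
    (Measure.absolutelyContinuous_of_le_smul h).ae_eq hfg
  have h2 := ae_of_ae_map hr.aemeasurable h1
  rw [ae_withDensity_iff (by fun_prop)] at h2
  filter_upwards [h2] with y hy
  by_cases h0 : k y = 0
  · simp [h0]
  · rw [hy (by simpa using h0)]

theorem WeightBound.eLpNorm_le (h : WeightBound μ ν r k C) (hr : Measurable r)
    (hk : Measurable k) {f : α → ℂ} (hf : Measurable f) :
    eLpNorm (fun y => k y * f (r y)) 2 ν ≤ (NNReal.sqrt C : ℝ≥0∞) * eLpNorm f 2 μ := by
  have key : ∫⁻ y, ‖k y * f (r y)‖ₑ ^ 2 ∂ν ≤ (C : ℝ≥0∞) * ∫⁻ x, ‖f x‖ₑ ^ 2 ∂μ := by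
    calc ∫⁻ y, ‖k y * f (r y)‖ₑ ^ 2 ∂ν
        = ∫⁻ y, ‖f (r y)‖ₑ ^ 2 ∂(ν.withDensity fun y => ‖k y‖ₑ ^ 2) := by
          rw [lintegral_withDensity_eq_lintegral_mul _ (by fun_prop) (by fun_prop)]
          simp [enorm_mul, mul_pow]
      _ = ∫⁻ x, ‖f x‖ₑ ^ 2 ∂((ν.withDensity fun y => ‖k y‖ₑ ^ 2).map r) := by
          rw [lintegral_map (by fun_prop) hr]
      _ ≤ ∫⁻ x, ‖f x‖ₑ ^ 2 ∂((C : ℝ≥0∞) • μ) := lintegral_mono' h le_rfl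
      _ = _ := by rw [lintegral_smul_measure, smul_eq_mul]
  have e2 : (2 : ℝ≥0∞).toReal = ((2 : ℕ) : ℝ) := by norm_num
  rw [eLpNorm_eq_lintegral_rpow_enorm_toReal (by norm_num) (by norm_num),
    eLpNorm_eq_lintegral_rpow_enorm_toReal (by norm_num) (by norm_num), e2]
  simp only [ENNReal.rpow_natCast]
  refine (ENNReal.rpow_le_rpow key (by norm_num)).trans ?_
  rw [ENNReal.mul_rpow_of_nonneg _ _ (by norm_num)]
  gcongr
  rw [NNReal.sqrt_eq_rpow, ← ENNReal.coe_rpow_of_nonneg _ (by norm_num)]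
  norm_num

theorem WeightBound.memLp (h : WeightBound μ ν r k C) (hr : Measurable r)
    (hk : Measurable k) (f : Lp ℂ 2 μ) : MemLp (fun y => k y * f (r y)) 2 ν :=
  ⟨(hk.mul ((Lp.stronglyMeasurable f).measurable.comp hr)).aestronglyMeasurable,
    (h.eLpNorm_le hr hk (Lp.stronglyMeasurable f).measurable).trans_lt
      (ENNReal.mul_lt_top ENNReal.coe_lt_top (Lp.eLpNorm_lt_top f))⟩

/-- The bounded operator `L²(μ) → L²(ν)`, `f ↦ k · (f ∘ r)`. -/
def weightedComp (h : WeightBound μ ν r k C) (hr : Measurable r) (hk : Measurable k) :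
    Lp ℂ 2 μ →L[ℂ] Lp ℂ 2 ν :=
  LinearMap.mkContinuous
    { toFun := fun f => (h.memLp hr hk f).toLp (fun y => k y * f (r y))
      map_add' := fun f g => by
        rw [← MemLp.toLp_add, MemLp.toLp_eq_toLp_iff]
        filter_upwards [h.ae_eq hr hk (Lp.coeFn_add f g)] with y hy
        rw [hy]
        simp [mul_add]
      map_smul' := fun c f => by
        rw [RingHom.id_apply, ← MemLp.toLp_const_smul, MemLp.toLp_eq_toLp_iff]
        filter_upwards [h.ae_eq hr hk (Lp.coeFn_smul c f)] with y hy
        rw [hy]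
        simp [mul_left_comm] }
    (NNReal.sqrt C)
    (fun f => by
      rw [LinearMap.coe_mk, AddHom.coe_mk, Lp.norm_toLp, Lp.norm_def, ← ENNReal.coe_toReal,
        ← ENNReal.toReal_mul]
      exact ENNReal.toReal_mono
        (ENNReal.mul_lt_top ENNReal.coe_lt_top (Lp.eLpNorm_lt_top f)).ne
        (h.eLpNorm_le hr hk (Lp.stronglyMeasurable f).measurable))

theorem weightedComp_coeFn (h : WeightBound μ ν r k C) (hr : Measurable r) (hk : Measurable k)
    (f : Lp ℂ 2 μ) : weightedComp h hr hk f =ᵐ[ν] fun y => k y * f (r y) :=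
  MemLp.coeFn_toLp (h.memLp hr hk f)

end WeightedComposition

/-- The measure `|p|ⁿ dp` on the line; only `n = 1` and `n = -1` are used. -/
def absMeasure (n : ℤ) : Measure ℝ :=
  volume.withDensity fun p => ENNReal.ofReal (|p| ^ n)

theorem measurePreserving_neg_absMeasure (n : ℤ) :
    MeasurePreserving (fun p : ℝ => -p) (absMeasure n) (absMeasure n) := by
  refine ⟨measurable_neg, ?_⟩
  ext s hs
  rw [Measure.map_apply measurable_neg hs, absMeasure, withDensity_apply _ hs,
    withDensity_apply _ (measurable_neg hs)]
  have := (Measure.measurePreserving_neg (volume : Measure ℝ)).setLIntegral_comp_preimage hs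
    (f := fun p => ENNReal.ofReal (|p| ^ n)) (by fun_prop)
  simpa using this

/-- `L²(ℝ²)`, with points `(q, p)`. -/
abbrev PhaseL2 : Type := Lp ℂ 2 (volume : Measure (ℝ × ℝ))

/-- `L²(ℝ, |p|ⁿ dp)`. -/
abbrev LineL2 (n : ℤ) : Type := Lp ℂ 2 (absMeasure n)

/-- The projector `(Π' f)(p) = (f(p) - f(-p)) / 2` on odd functions. -/
def oddProj (n : ℤ) : LineL2 n →L[ℂ] LineL2 n :=
  (1 / 2 : ℂ) • (ContinuousLinearMap.id ℂ (LineL2 n) -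
    (Lp.compMeasurePreservingₗᵢ ℂ (fun p : ℝ => -p)
      (measurePreserving_neg_absMeasure n)).toContinuousLinearMap)

/-- `g_z(q,p) = θ(q p Im z) sgn(Im z) (i m / |p|) exp(i m z q / p)`, as a function of `(q, p)`. -/
def green (m : ℝ) (z : ℂ) (x : ℝ × ℝ) : ℂ :=
  (if 0 < x.1 * x.2 * z.im then 1 else 0) * (SignType.sign z.im : ℂ) * (I * m / (|x.2| : ℝ)) *
    exp (I * m * z * x.1 / x.2)

theorem measurable_green (m : ℝ) (z : ℂ) : Measurable (green m z) := by
  unfold green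
  refine Measurable.mul (Measurable.mul (Measurable.mul ?_ measurable_const) ?_) ?_
  · exact Measurable.ite (measurableSet_lt measurable_const (by fun_prop))
      measurable_const measurable_const
  · fun_prop
  · fun_prop


theorem lintegral_exp_neg_mul_abs {c : ℝ} (hc : 0 < c) :
    ∫⁻ q : ℝ, ENNReal.ofReal (Real.exp (-c * |q|)) = ENNReal.ofReal (2 / c) := by
  have h1 : ∫ q : ℝ, Real.exp (-c * |q|) = 2 / c := by
    rw [integral_comp_abs (f := fun x => Real.exp (-c * x)),
      integral_exp_mul_Ioi (by linarith) 0]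
    simp
    field_simp
  rw [← ofReal_integral_eq_lintegral_ofReal _ (Filter.Eventually.of_forall fun q => by positivity),
    h1]
  exact Integrable.of_integral_ne_zero (by rw [h1]; positivity)

theorem enorm_green_le {m : ℝ} (hm : 0 < m) {z : ℂ} (q p : ℝ) (hp : p ≠ 0) :
    ‖green m z (q, p)‖ₑ ^ 2 ≤ ENNReal.ofReal (m ^ 2 / p ^ 2) *
      ENNReal.ofReal (Real.exp (-(2 * m * |z.im| / |p|) * |q|)) := by
  rw [← ofReal_norm, ← ENNReal.ofReal_pow (norm_nonneg _),
    ← ENNReal.ofReal_mul (by positivity)]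
  apply ENNReal.ofReal_le_ofReal
  unfold green
  split_ifs with h
  · have hs : ‖((SignType.sign z.im : ℝ) : ℂ)‖ ≤ 1 := by
      rcases SignType.sign z.im with _ | _ | _ <;> simp
    have he : (I * m * z * q / p).re = -(m * |z.im| / |p|) * |q| := by
      have h1 : (I * m * z * q / p).re = -(m * z.im * q / p) := by
        rw [show I * m * z * q / p = (((m * q / p : ℝ) : ℂ)) * (I * z) by push_cast; ring]
        rw [Complex.re_ofReal_mul]
        simp
        ring
      have h2 : |z.im| * |q| * |p| = z.im * q * p := by
        rw [← abs_mul, ← abs_mul, abs_of_pos]; linarith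
      rw [h1]
      have hp' : 0 < |p| := abs_pos.mpr hp
      have h3 : |p| * |p| = p * p := abs_mul_abs_self p
      have : m * z.im * q / p = m * |z.im| / |p| * |q| := by
        rw [div_mul_eq_mul_div, div_eq_div_iff hp hp'.ne']
        apply mul_right_cancel₀ hp
        calc m * z.im * q * |p| * p = m * |p| * (z.im * q * p) := by ring
          _ = m * |z.im| * |q| * (|p| * |p|) := by rw [← h2]; ring
          _ = _ := by rw [h3]; ring
      linarith
    have e1 : ‖(1 : ℂ) * (SignType.sign z.im : ℂ) * (I * m / (|p| : ℝ)) *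
        exp (I * m * z * q / p)‖ ≤ m / |p| * Real.exp (-(m * |z.im| / |p|) * |q|) := by
      rw [norm_mul, norm_mul, Complex.norm_exp, he, one_mul]
      have : ‖(I * m / (|p| : ℝ) : ℂ)‖ = m / |p| := by
        simp [abs_of_pos hm]
      rw [this]
      have hs' : ‖(SignType.sign z.im : ℂ)‖ ≤ 1 := by
        rcases SignType.sign z.im with _ | _ | _ <;> simp
      have : 0 ≤ m / |p| := by positivity
      gcongr
      nlinarith
    calc _ ≤ (m / |p| * Real.exp (-(m * |z.im| / |p|) * |q|)) ^ 2 := by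
          gcongr
      _ = _ := by
          rw [mul_pow, div_pow, sq_abs, ← Real.exp_nat_mul]
          congr 2
          push_cast
          ring
  · simp
    positivity

theorem weightBound_green {m : ℝ} (hm : 0 < m) {z : ℂ} (hz : z.im ≠ 0) :
    WeightBound (absMeasure (-1)) (volume : Measure (ℝ × ℝ)) Prod.snd (green m z)
      (Real.toNNReal (m / |z.im|)) := by
  have hz' : 0 < |z.im| := abs_pos.mpr hz
  have hg := measurable_green m z
  refine Measure.le_iff.mpr fun s hs => ?_
  rw [Measure.map_apply measurable_snd hs, withDensity_apply _ (measurable_snd hs),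
    ← lintegral_indicator (measurable_snd hs), Measure.volume_eq_prod,
    lintegral_prod_symm _ (Measurable.aemeasurable
      (Measurable.indicator (by fun_prop) (measurable_snd hs))),
    Measure.smul_apply, absMeasure, withDensity_apply _ hs, smul_eq_mul,
    ← lintegral_const_mul _ (by fun_prop), ← lintegral_indicator hs]
  apply lintegral_mono_ae
  have h0 : ∀ᵐ p : ℝ, p ≠ 0 := by simp [ae_iff, measure_singleton]
  filter_upwards [h0] with p hp
  by_cases hps : p ∈ s
  · have hp' : 0 < |p| := abs_pos.mpr hp
    have : ∀ q : ℝ, (Prod.snd ⁻¹' s).indicator (fun y : ℝ × ℝ => ‖green m z y‖ₑ ^ 2) (q, p)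
        = ‖green m z (q, p)‖ₑ ^ 2 := fun q => Set.indicator_of_mem (by simpa using hps) _
    simp only [this, Set.indicator_of_mem hps]
    refine (lintegral_mono fun q => enorm_green_le hm q p hp).trans ?_
    rw [lintegral_const_mul _ (by fun_prop), lintegral_exp_neg_mul_abs (by positivity),
      ← ENNReal.ofReal_mul (by positivity), ENNReal.ofNNReal_toNNReal,
      ← ENNReal.ofReal_mul (by positivity)]
    apply ENNReal.ofReal_le_ofReal
    rw [← sq_abs p, zpow_neg_one]
    apply le_of_eq
    field_simp
  · have : ∀ q : ℝ, (Prod.snd ⁻¹' s).indicator (fun y : ℝ × ℝ => ‖green m z y‖ₑ ^ 2) (q, p)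
        = 0 := fun q => Set.indicator_of_notMem (by simpa using hps) _
    simp [this]

/-- The bounded operator `G_z : L²(ℝ, |p|⁻¹dp) → L²(ℝ²)`, `(G_z φ)(q,p) = g_z(q,p) φ(p)`. -/
def opG {m : ℝ} (hm : 0 < m) {z : ℂ} (hz : z.im ≠ 0) : LineL2 (-1) →L[ℂ] PhaseL2 :=
  weightedComp (weightBound_green hm hz) measurable_snd (measurable_green m z)

theorem weightBound_id {n n' : ℤ} {k : ℝ → ℂ} {C : ℝ≥0} (hk : Measurable k)
    (h : ∀ p : ℝ, |p| ^ n' * ‖k p‖ ^ 2 ≤ C * |p| ^ n) :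
    WeightBound (absMeasure n) (absMeasure n') id k C := by
  unfold WeightBound absMeasure
  rw [Measure.map_id, ← withDensity_mul _ (by fun_prop) (by fun_prop),
    ← withDensity_smul _ (by fun_prop)]
  refine withDensity_mono (Filter.Eventually.of_forall fun p => ?_)
  simp only [Pi.mul_apply, Pi.smul_apply, smul_eq_mul]
  rw [← ofReal_norm, ← ENNReal.ofReal_pow (norm_nonneg _),
    ← ENNReal.ofReal_mul (by positivity), ← ENNReal.ofReal_coe_nnreal,
    ← ENNReal.ofReal_mul (by positivity)]
  exact ENNReal.ofReal_le_ofReal (h p)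

theorem measurable_invAbs : Measurable fun p : ℝ => (((|p|)⁻¹ : ℝ) : ℂ) := by fun_prop

theorem weightBound_invAbs :
    WeightBound (absMeasure (-1)) (absMeasure 1) id (fun p => (((|p|)⁻¹ : ℝ) : ℂ)) 1 := by
  refine weightBound_id measurable_invAbs fun p => ?_
  rcases eq_or_ne p 0 with rfl | hp
  · simp
  · have hp' : 0 < |p| := abs_pos.mpr hp
    simp only [zpow_one, zpow_neg_one, norm_real, norm_inv, Real.norm_eq_abs, abs_abs,
      NNReal.coe_one, one_mul]
    apply le_of_eq
    field_simp

/-- The adjoint `T^* : L²(ℝ²) → L²(ℝ, |p|dp)` of `T : L²(ℝ, |p|⁻¹dp) → L²(ℝ²)` for the duality of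
`L²(ℝ, |p|⁻¹dp)` and `L²(ℝ, |p|dp)` induced by the scalar product of `L²(ℝ, dp)`:
`∫ conj(φ) (T^* f) dp = ⟪T φ, f⟫`. Hence `T^* f = |p|⁻¹ T† f`, with `T†` the Hilbert adjoint. -/
def dualAdjoint (T : LineL2 (-1) →L[ℂ] PhaseL2) : PhaseL2 →L[ℂ] LineL2 1 :=
  weightedComp weightBound_invAbs measurable_id measurable_invAbs ∘L
    ContinuousLinearMap.adjoint T

/-- `B(p) = b p²` for real `b`, and `B(p) = ∞` for `b = ∞`. -/
def coupling (b : OnePoint ℝ) (p : ℝ) : OnePoint ℝ :=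
  b.map fun b => b * p ^ 2

/-- `1 / x`, with `1 / ∞ = 0`. -/
def recip (x : OnePoint ℝ) : ℝ :=
  x.elim 0 fun x => 1 / x

/-- The function by which `Λ^B_z` multiplies: `1 / (1 / B(p) - sgn(Im z) i m / (2 |p|))`. -/
def symbolΛ (m : ℝ) (b : OnePoint ℝ) (z : ℂ) (p : ℝ) : ℂ :=
  1 / ((recip (coupling b p) : ℂ) - (SignType.sign z.im : ℂ) * (I * m / (2 * (|p| : ℝ))))

theorem measurable_symbolΛ (m : ℝ) (b : OnePoint ℝ) (z : ℂ) : Measurable (symbolΛ m b z) := by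
  have h : Measurable fun p => recip (coupling b p) := by
    induction b using OnePoint.rec with
    | infty => exact measurable_const
    | coe b =>
      change Measurable fun p : ℝ => 1 / (b * p ^ 2)
      fun_prop
  unfold symbolΛ
  fun_prop

theorem weightBound_symbolΛ {m : ℝ} (hm : 0 < m) (b : OnePoint ℝ) {z : ℂ} (hz : z.im ≠ 0) :
    WeightBound (absMeasure 1) (absMeasure (-1)) id (symbolΛ m b z)
      (Real.toNNReal ((2 / m) ^ 2)) := by
  refine weightBound_id (measurable_symbolΛ m b z) fun p => ?_
  rcases eq_or_ne p 0 with rfl | hp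
  · simp
  · have hp' : 0 < |p| := abs_pos.mpr hp
    have hk : ‖symbolΛ m b z p‖ ≤ 2 * |p| / m := by
      unfold symbolΛ
      rw [norm_div, norm_one, one_div]
      have hlow : m / (2 * |p|) ≤ ‖(recip (coupling b p) : ℂ) -
          (SignType.sign z.im : ℂ) * (I * m / (2 * (|p| : ℝ)))‖ := by
        refine le_trans (le_of_eq ?_) (Complex.abs_im_le_norm _)
        have e : (I * m / (2 * (|p| : ℝ)) : ℂ) = ((m / (2 * |p|) : ℝ) : ℂ) * I := by
          push_cast; ring
        have ht : 0 < m / (2 * |p|) := by positivity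
        rw [e]
        generalize m / (2 * |p|) = t at ht ⊢
        rcases lt_or_gt_of_ne hz with h | h
        · simp [sign_neg h, abs_of_pos ht]
        · simp [sign_pos h, abs_of_pos ht]
      calc _ ≤ (m / (2 * |p|))⁻¹ := inv_anti₀ (by positivity) hlow
        _ = _ := by rw [inv_div]
    rw [Real.coe_toNNReal _ (by positivity), zpow_one, zpow_neg_one]
    calc |p|⁻¹ * ‖symbolΛ m b z p‖ ^ 2 ≤ |p|⁻¹ * (2 * |p| / m) ^ 2 := by gcongr
      _ = _ := by field_simp

/-- The bounded operator `Λ^B_z : L²(ℝ, |p|dp) → L²(ℝ, |p|⁻¹dp)`. -/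
def opΛ {m : ℝ} (hm : 0 < m) (b : OnePoint ℝ) {z : ℂ} (hz : z.im ≠ 0) :
    LineL2 1 →L[ℂ] LineL2 (-1) :=
  weightedComp (weightBound_symbolΛ hm b hz) measurable_id (measurable_symbolΛ m b z)

/-- The Hamiltonian vector field `X₀(q,p) = (p/m, 0)` of a free particle. -/
def freeField (m : ℝ) (x : ℝ × ℝ) : ℝ × ℝ := (x.2 / m, 0)

/-- `X₀ · ∇f = h` in the sense of distributions on `ℝ²` (recall that `div X₀ = 0`). -/
def HasWeakTransport (m : ℝ) (f h : PhaseL2) : Prop :=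
  ∀ φ : ℝ × ℝ → ℂ, ContDiff ℝ ∞ φ → HasCompactSupport φ →
    ∫ x, f x * fderiv ℝ φ x (freeField m x) = -∫ x, h x * φ x

theorem integrable_mul_of_hasCompactSupport (f : PhaseL2) {φ : ℝ × ℝ → ℂ} (hφ : Continuous φ)
    (hc : HasCompactSupport φ) : Integrable fun x => f x * φ x :=
  (Lp.memLp f).integrable_mul (q := 2) (hφ.memLp_of_hasCompactSupport hc)

theorem integrable_mul_transport (m : ℝ) (f : PhaseL2) {φ : ℝ × ℝ → ℂ} (hφ : ContDiff ℝ ∞ φ)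
    (hc : HasCompactSupport φ) : Integrable fun x => f x * fderiv ℝ φ x (freeField m x) := by
  refine integrable_mul_of_hasCompactSupport f ?_ ?_
  · have h1 : Continuous (fderiv ℝ φ) := hφ.continuous_fderiv (by simp)
    have h2 : Continuous (freeField m) := by unfold freeField; fun_prop
    exact h1.clm_apply h2
  · exact (hc.fderiv ℝ).mono fun x hx => by
      contrapose! hx
      simp only [Function.mem_support, ne_eq, not_not] at hx ⊢
      simp [hx]

theorem HasWeakTransport.add {m : ℝ} {f h f' h' : PhaseL2} (H : HasWeakTransport m f h)
    (H' : HasWeakTransport m f' h') : HasWeakTransport m (f + f') (h + h') := by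
  intro φ hφ hc
  have e1 : ∫ x, (f + f' : PhaseL2) x * fderiv ℝ φ x (freeField m x) =
      ∫ x, (f x * fderiv ℝ φ x (freeField m x) + f' x * fderiv ℝ φ x (freeField m x)) := by
    refine integral_congr_ae ?_
    filter_upwards [Lp.coeFn_add f f'] with x hx
    rw [hx, Pi.add_apply, add_mul]
  have e2 : ∫ x, (h + h' : PhaseL2) x * φ x = ∫ x, (h x * φ x + h' x * φ x) := by
    refine integral_congr_ae ?_
    filter_upwards [Lp.coeFn_add h h'] with x hx
    rw [hx, Pi.add_apply, add_mul]
  rw [e1, e2, integral_add (integrable_mul_transport m f hφ hc)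
    (integrable_mul_transport m f' hφ hc),
    integral_add (integrable_mul_of_hasCompactSupport h hφ.continuous hc)
    (integrable_mul_of_hasCompactSupport h' hφ.continuous hc), H φ hφ hc, H' φ hφ hc, neg_add]

theorem HasWeakTransport.smul {m : ℝ} {f h : PhaseL2} (c : ℂ) (H : HasWeakTransport m f h) :
    HasWeakTransport m (c • f) (c • h) := by
  intro φ hφ hc
  have e1 : ∫ x, (c • f : PhaseL2) x * fderiv ℝ φ x (freeField m x) =
      ∫ x, c * (f x * fderiv ℝ φ x (freeField m x)) := by
    refine integral_congr_ae ?_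
    filter_upwards [Lp.coeFn_smul c f] with x hx
    rw [hx, Pi.smul_apply, smul_eq_mul, mul_assoc]
  have e2 : ∫ x, (c • h : PhaseL2) x * φ x = ∫ x, c * (h x * φ x) := by
    refine integral_congr_ae ?_
    filter_upwards [Lp.coeFn_smul c h] with x hx
    rw [hx, Pi.smul_apply, smul_eq_mul, mul_assoc]
  rw [e1, e2, integral_const_mul, integral_const_mul, H φ hφ hc, mul_neg]

theorem HasWeakTransport.eq_zero {m : ℝ} {h : PhaseL2} (H : HasWeakTransport m 0 h) : h = 0 := by
  have hloc : LocallyIntegrable (h : ℝ × ℝ → ℂ) volume :=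
    (Lp.memLp h).locallyIntegrable (by norm_num)
  have h0 := ae_eq_zero_of_integral_contDiff_smul_eq_zero hloc fun g hg hgc => by
    have hg' : ContDiff ℝ ∞ fun x => (g x : ℂ) := Complex.ofRealCLM.contDiff.comp hg
    have hgc' : HasCompactSupport fun x => (g x : ℂ) := hgc.comp_left Complex.ofReal_zero
    have e := H _ hg' hgc'
    have e1 : ∫ x, (0 : PhaseL2) x * fderiv ℝ (fun x => (g x : ℂ)) x (freeField m x) = 0 := by
      refine integral_eq_zero_of_ae ?_
      filter_upwards [Lp.coeFn_zero ℂ 2 (volume : Measure (ℝ × ℝ))] with x hx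
      simp
    rw [e1, eq_comm, neg_eq_zero] at e
    rw [← e]
    congr 1
    ext x
    rw [real_smul, mul_comm]
  exact Lp.eq_zero_iff_ae_eq_zero.mpr h0

/-- The graph of `f ↦ -i X₀ · ∇f` on the maximal domain `{f ∈ L² | X₀ · ∇f ∈ L²}`. -/
def freeGraph (m : ℝ) : Submodule ℂ (PhaseL2 × PhaseL2) where
  carrier := {x | ∃ h : PhaseL2, HasWeakTransport m x.1 h ∧ x.2 = -I • h}
  zero_mem' := ⟨0, fun φ _ _ => by
    have h0 := Lp.coeFn_zero ℂ 2 (volume : Measure (ℝ × ℝ))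
    rw [integral_eq_zero_of_ae, integral_eq_zero_of_ae, neg_zero]
    all_goals filter_upwards [h0] with x hx
    all_goals simp, by simp⟩
  add_mem' := by
    rintro x y ⟨h, H, e⟩ ⟨h', H', e'⟩
    exact ⟨h + h', H.add H', by rw [Prod.snd_add, e, e', smul_add]⟩
  smul_mem' := by
    rintro c x ⟨h, H, e⟩
    exact ⟨c • h, H.smul c, by rw [Prod.smul_snd, e, smul_comm]⟩

theorem freeGraph_single_valued (m : ℝ) (x : PhaseL2 × PhaseL2) (hx : x ∈ freeGraph m)
    (hx' : x.1 = 0) : x.2 = 0 := by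
  obtain ⟨h, H, e⟩ := hx
  rw [hx'] at H
  rw [e, H.eq_zero, smul_zero]

/-- The free operator `L₀ f = -i X₀ · ∇f` on its maximal domain. -/
def freeOp (m : ℝ) : PhaseL2 →ₗ.[ℂ] PhaseL2 := (freeGraph m).toLinearPMap

theorem freeOp_graph (m : ℝ) : (freeOp m).graph = freeGraph m :=
  Submodule.toLinearPMap_graph_eq _ (freeGraph_single_valued m)

/-- `φ` is the trace `p ↦ f(0,p)` of `f`: there is a representative of `f` which is continuous in
`q` for almost every `p`, and whose values at `q = 0` are those of `φ`. -/
def IsTrace (f : PhaseL2) (φ : LineL2 1) : Prop :=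
  ∃ F : ℝ × ℝ → ℂ, f =ᵐ[volume] F ∧ (∀ᵐ p : ℝ, Continuous fun q => F (q, p)) ∧
    φ =ᵐ[absMeasure 1] fun p => F (0, p)

theorem IsTrace.unique {f : PhaseL2} {φ ψ : LineL2 1} (h : IsTrace f φ) (h' : IsTrace f ψ) :
    φ = ψ := by
  obtain ⟨F, hF, cF, eF⟩ := h
  obtain ⟨G, hG, cG, eG⟩ := h'
  have hFG : ∀ᵐ x : ℝ × ℝ, F x = G x := by
    filter_upwards [hF, hG] with x h1 h2
    rw [← h1, h2]
  have hsw : ∀ᵐ x : ℝ × ℝ, F x.swap = G x.swap :=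
    (Measure.measurePreserving_swap (μ := (volume : Measure ℝ))
      (ν := (volume : Measure ℝ))).quasiMeasurePreserving.ae hFG
  have hsl : ∀ᵐ p : ℝ, ∀ᵐ q : ℝ, F (q, p) = G (q, p) := Measure.ae_ae_of_ae_prod hsw
  have h0 : ∀ᵐ p : ℝ, F (0, p) = G (0, p) := by
    filter_upwards [hsl, cF, cG] with p hp c1 c2
    exact congrFun (Continuous.ae_eq_iff_eq volume c1 c2 |>.mp hp) 0
  have h1 : ∀ᵐ p ∂(absMeasure 1), F (0, p) = G (0, p) :=
    (withDensity_absolutelyContinuous _ _).ae_le h0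
  refine Lp.ext ?_
  filter_upwards [eF, eG, h1] with p a b c
  rw [a, b, c]

open Classical in
/-- The trace map `γ : dom(L₀) → L²(ℝ, |p|dp)`, `(γ f)(p) = f(0,p)`. By `IsTrace.unique` there is
at most one linear map as required. -/
def traceMap (m : ℝ) : (freeOp m).domain →ₗ[ℂ] LineL2 1 :=
  if h : ∃ T : (freeOp m).domain →ₗ[ℂ] LineL2 1, ∀ u : (freeOp m).domain, IsTrace (u : PhaseL2) (T u) then h.choose else 0

/-- The bounded operator `R` is the resolvent `(T - z)⁻¹` of `T`. -/
def IsResolvent (T : PhaseL2 →ₗ.[ℂ] PhaseL2) (z : ℂ) (R : PhaseL2 →L[ℂ] PhaseL2) : Prop :=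
  (∀ f, ∃ h : R f ∈ T.domain, T ⟨R f, h⟩ - z • R f = f) ∧
    ∀ u : T.domain, R (T u - z • (u : PhaseL2)) = u

open Classical in
/-- The free resolvent `R⁰_z = (L₀ - z)⁻¹`. -/
def freeResolvent (m : ℝ) (z : ℂ) : PhaseL2 →L[ℂ] PhaseL2 :=
  if h : ∃ R, IsResolvent (freeOp m) z R then h.choose else 0

/-- The restriction of `L₀` to `ker γ`. -/
def freeOpKer (m : ℝ) : PhaseL2 →ₗ.[ℂ] PhaseL2 :=
  (freeOp m).domRestrict ((LinearMap.ker (traceMap m)).map (freeOp m).domain.subtype)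

theorem conj_im_ne_zero {z : ℂ} (hz : z.im ≠ 0) : (conj z).im ≠ 0 := by
  rwa [conj_im, neg_ne_zero]

/-- `R^B_z = R⁰_z + G_z Π' Λ^B_z Π' G_{z̄}^*`. -/
def kreinResolvent {m : ℝ} (hm : 0 < m) (b : OnePoint ℝ) {z : ℂ} (hz : z.im ≠ 0) :
    PhaseL2 →L[ℂ] PhaseL2 :=
  freeResolvent m z +
    opG hm hz ∘L oddProj (-1) ∘L opΛ hm b hz ∘L oddProj 1 ∘L
      dualAdjoint (opG hm (conj_im_ne_zero hz))

end DeltaPrime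

end

open DeltaPrime MeasureTheory
open scoped ComplexConjugate

noncomputable section

namespace DeltaPrime

open MeasureTheory Complex
open scoped ENNReal NNReal ContDiff ComplexConjugate

/-! ### Resolvent families and self-adjointness -/

section Abstract

/-! A family of injective bounded operators `R_z` with `R_z - R_w = (z - w) R_w R_z` consists of the
resolvents of a single operator, and `R_z† = R_{z̄}` makes that operator self-adjoint. The proof
checks these properties for `R^B_z`.

Absorbing the weight `|p|⁻¹` of the duality into `M_z = Π' Λ_z Π' |p|⁻¹` (`boundaryOp`) leaves only
Hilbert adjoints: `R^B_z = R⁰_z + G_z M_z G_{z̄}†`. With `s_z = sgn (Im z)`, the resolvent identity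
rests on three facts: `G_z - G_w = (z - w) R⁰_w G_z` (`opG_sub_opG`); `(z - w) G_{w̄}† G_z = (s_z -
s_w) i m / 2`, a scalar (`adjoint_opG_opG`); `M_z - M_w = (s_z - s_w) (i m / 2) M_w M_z`
(`boundaryOp_identity`). The last holds because `1/B` cancels in the difference of the denominators
of `Λ_z` and `Λ_w`, and because even multipliers commute with `Π'`. The adjoint relation holds
because `1/B` is real. Injectivity holds because the range of `G_z` meets `dom L₀` only in `0`.

The free part comes from the unitary group of the flow `(q, p) ↦ (q + t p / m, p)`. Its Laplace
transform is `R⁰_z`, which is convolution in `q` with `g_z`. So `u = R⁰_{z̄} (L₀ - z̄) u` has a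
representative continuous in `q`, and its value at `q = 0` gives `γ u = G_z^* (L₀ - z̄) u`. This
formula yields the bound for `γ`, the closedness of `L₀ ↾ ker γ`, and `R^B_z (L₀ - z) u = u + G_z
Λ_z Π' γ u`, from which the domain and the action of `L_B` are read off. -/

/-- An operator with resolvents at `z` and `conj z` which are adjoint to each other is
self-adjoint. -/
theorem isSelfAdjoint_of_isResolvent {T : PhaseL2 →ₗ.[ℂ] PhaseL2} {z : ℂ}
    {R R' : PhaseL2 →L[ℂ] PhaseL2} (hR : IsResolvent T z R) (hR' : IsResolvent T (conj z) R')
    (hadj : ∀ f g, inner ℂ (R f) g = inner ℂ f (R' g)) : IsSelfAdjoint T := by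
  have hdense : Dense (T.domain : Set PhaseL2) := by
    rw [Submodule.dense_iff_topologicalClosure_eq_top,
      Submodule.topologicalClosure_eq_top_iff, Submodule.eq_bot_iff]
    intro g hg
    -- The domain contains the range of `R`, so a vector orthogonal to it is killed by `R' = R†`,
    -- which is injective.
    have h0 : R' g = 0 := by
      refine ext_inner_left ℂ fun f => ?_
      rw [inner_zero_right, ← hadj]
      exact (Submodule.mem_orthogonal _ _).1 hg _ (hR.1 f).1
    obtain ⟨h, e⟩ := hR'.1 g
    have : (⟨R' g, h⟩ : T.domain) = 0 := Subtype.ext h0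
    rw [this, h0, LinearPMap.map_zero, smul_zero, sub_zero] at e
    exact e.symm
  have hsymm : T.IsFormalAdjoint T := by
    intro y x
    have h := hadj (T y - z • (y : PhaseL2)) (T x - conj z • (x : PhaseL2))
    rw [hR.2, hR'.2, inner_sub_left, inner_sub_right, inner_smul_left, inner_smul_right] at h
    linear_combination -h
  rw [LinearPMap.isSelfAdjoint_def]
  have hle : T ≤ T.adjoint := hsymm.le_adjoint hdense
  refine le_antisymm ?_ hle
  refine ⟨?_, ?_⟩
  · intro y hy
    let y' : T.adjoint.domain := ⟨y, hy⟩
    obtain ⟨h, e⟩ := hR'.1 (T.adjoint y' - conj z • y)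
    -- Tested against any `f = (T - z) R f`, both sides agree; thus `y` lies in the range of `R'`,
    -- hence in the domain of `T`.
    have key : y = R' (T.adjoint y' - conj z • y) := by
      refine ext_inner_right ℂ fun f => ?_
      obtain ⟨h1, e1⟩ := hR.1 f
      have a := LinearPMap.adjoint_isFormalAdjoint hdense y' ⟨R f, h1⟩
      change inner ℂ (T.adjoint y') (R f) = inner ℂ y _ at a
      have e2 : T ⟨R f, h1⟩ = f + z • R f := sub_eq_iff_eq_add.1 e1
      rw [e2] at a
      have b : inner ℂ (R' (T.adjoint y' - conj z • y)) f
          = inner ℂ (T.adjoint y' - conj z • y) (R f) := by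
        rw [← inner_conj_symm, ← hadj, inner_conj_symm]
      rw [b, inner_sub_left, a, inner_add_right, inner_smul_left, inner_smul_right]
      simp
    rw [key]
    exact h
  · intro x y hxy
    have := hle.2 (x := y) (y := x) hxy.symm
    exact this.symm

/-- An injective family of bounded operators satisfying the resolvent identity is the family of
resolvents of an operator. -/
theorem exists_isResolvent_of_resolventIdentity
    (R : ∀ z : ℂ, z.im ≠ 0 → PhaseL2 →L[ℂ] PhaseL2)
    (hinj : ∀ z hz f, R z hz f = 0 → f = 0)
    (hid : ∀ z w hz hw f, R z hz f - R w hw f = (z - w) • R w hw (R z hz f)) :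
    ∃ T : PhaseL2 →ₗ.[ℂ] PhaseL2, ∀ z hz, IsResolvent T z (R z hz) := by
  have hI : I.im ≠ 0 := by simp
  let A : PhaseL2 →ₗ[ℂ] PhaseL2 := (R I hI).toLinearMap
  have hA : Function.Injective A := (injective_iff_map_eq_zero A).2 fun f hf => hinj I hI f hf
  let E := LinearEquiv.ofInjective A hA
  -- `T = R_i⁻¹ + i` on the range of `R_i`. The identity for the pair `(w, i)` puts the range of
  -- `R_w` into this domain; for `(i, w)` it gives the left inverse.
  let T : PhaseL2 →ₗ.[ℂ] PhaseL2 :=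
    { domain := LinearMap.range A
      toFun := E.symm.toLinearMap + I • (LinearMap.range A).subtype }
  have hT : ∀ (a : PhaseL2) (u : T.domain), (u : PhaseL2) = R I hI a → T u = a + I • R I hI a := by
    intro a u hu
    have : u = E a := Subtype.ext hu
    subst this
    change E.symm (E a) + I • ((E a : LinearMap.range A) : PhaseL2) = _
    rw [LinearEquiv.symm_apply_apply]
    rfl
  refine ⟨T, fun w hw => ⟨fun f => ?_, fun u => ?_⟩⟩
  · have e : R w hw f = R I hI (f + (w - I) • R w hw f) := by
      rw [map_add, map_smul, ← hid w I hw hI f]; abel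
    refine ⟨⟨_, e.symm⟩, ?_⟩
    rw [hT _ _ e, ← e]
    module
  · obtain ⟨a, ha⟩ := u.2
    have ha' : (u : PhaseL2) = R I hI a := ha.symm
    rw [hT a u ha', ha']
    have h := hid I w hI hw a
    have e2 : a + I • R I hI a - w • R I hI a = a + (I - w) • R I hI a := by module
    rw [e2, map_add, map_smul, ← h]
    abel

end Abstract

/-! ### The free flow on phase space and on `L²` -/

section Flow

/-- The flow `(q, p) ↦ (q + t p / m, p)` of a free particle. -/
def freeFlow (m t : ℝ) (x : ℝ × ℝ) : ℝ × ℝ := (x.1 + t * (x.2 / m), x.2)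

theorem freeFlow_zero (m : ℝ) (x : ℝ × ℝ) : freeFlow m 0 x = x := by simp [freeFlow]

theorem freeFlow_freeFlow (m s t : ℝ) (x : ℝ × ℝ) :
    freeFlow m s (freeFlow m t x) = freeFlow m (s + t) x := by
  simp only [freeFlow, Prod.mk.injEq, and_true]; ring

theorem freeFlow_neg_freeFlow (m t : ℝ) (x : ℝ × ℝ) : freeFlow m (-t) (freeFlow m t x) = x := by
  rw [freeFlow_freeFlow, neg_add_cancel, freeFlow_zero]

theorem freeFlow_freeFlow_neg (m t : ℝ) (x : ℝ × ℝ) : freeFlow m t (freeFlow m (-t) x) = x := by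
  rw [freeFlow_freeFlow, add_neg_cancel, freeFlow_zero]

theorem continuous_freeFlow_uncurry (m : ℝ) :
    Continuous fun y : ℝ × (ℝ × ℝ) => freeFlow m y.1 y.2 := by
  unfold freeFlow; fun_prop

theorem continuous_freeFlow (m t : ℝ) : Continuous (freeFlow m t) := by
  unfold freeFlow; fun_prop

theorem contDiff_freeFlow (m t : ℝ) : ContDiff ℝ ∞ (freeFlow m t) := by
  unfold freeFlow; fun_prop

theorem hasDerivAt_freeFlow (m t : ℝ) (x : ℝ × ℝ) :
    HasDerivAt (fun t => freeFlow m t x) (freeField m x) t := by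
  unfold freeFlow freeField
  refine HasDerivAt.prodMk ?_ (hasDerivAt_const _ _)
  simpa using ((hasDerivAt_id t).mul_const (x.2 / m)).const_add x.1

/-- With the coordinates swapped, the flow is a skew product over `p` of translations in `q`. -/
theorem measurePreserving_freeFlow (m t : ℝ) :
    MeasurePreserving (freeFlow m t) (volume : Measure (ℝ × ℝ)) volume := by
  have h1 : MeasurePreserving (fun y : ℝ × ℝ => (id y.1, y.2 + t * (y.1 / m)))
      ((volume : Measure ℝ).prod volume) ((volume : Measure ℝ).prod volume) :=
    (MeasurePreserving.id (volume : Measure ℝ)).skew_product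
      (g := fun p q => q + t * (p / m)) (by unfold Function.uncurry; fun_prop)
      (Filter.Eventually.of_forall fun p => map_add_right_eq_self volume _)
  have h2 := Measure.measurePreserving_swap (μ := (volume : Measure ℝ))
    (ν := (volume : Measure ℝ))
  exact (h2.comp h1).comp h2

/-- `f ↦ f ∘ Φ_t` on `L²(ℝ²)`, with `Φ_t` the free flow. -/
def flowOp (m t : ℝ) : PhaseL2 →ₗᵢ[ℂ] PhaseL2 :=
  Lp.compMeasurePreservingₗᵢ ℂ (freeFlow m t) (measurePreserving_freeFlow m t)

theorem flowOp_coeFn (m t : ℝ) (f : PhaseL2) : flowOp m t f =ᵐ[volume] fun x => f (freeFlow m t x) :=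
  Lp.coeFn_compMeasurePreserving f (measurePreserving_freeFlow m t)

theorem flowOp_flowOp_neg (m t : ℝ) (f : PhaseL2) : flowOp m t (flowOp m (-t) f) = f := by
  refine Lp.ext ?_
  filter_upwards [flowOp_coeFn m t (flowOp m (-t) f),
    (measurePreserving_freeFlow m t).quasiMeasurePreserving.ae (flowOp_coeFn m (-t) f)] with x h1 h2
  rw [h1, h2, freeFlow_neg_freeFlow]

theorem inner_flowOp_left (m t : ℝ) (f g : PhaseL2) :
    inner ℂ (flowOp m t f) g = inner ℂ f (flowOp m (-t) g) := by
  conv_lhs => rw [← flowOp_flowOp_neg m t g]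
  exact (flowOp m t).inner_map_map f _

theorem continuous_flowOp (m : ℝ) (f : PhaseL2) : Continuous fun t => flowOp m t f := by
  let F : ℝ → C(ℝ × ℝ, ℝ × ℝ) := fun t => ⟨freeFlow m t, continuous_freeFlow m t⟩
  have hF : Continuous F := ContinuousMap.continuous_of_continuous_uncurry _
    (continuous_freeFlow_uncurry m)
  have hmp : ∀ t, MeasurePreserving (F t) (volume : Measure (ℝ × ℝ)) volume :=
    measurePreserving_freeFlow m
  exact Continuous.compMeasurePreservingLp (f := fun _ => f) continuous_const hF hmp (by norm_num)

theorem integral_flowOp_mul (m t : ℝ) (f : PhaseL2) (φ : ℝ × ℝ → ℂ) :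
    ∫ x, flowOp m t f x * φ x = ∫ x, f x * φ (freeFlow m (-t) x) := by
  have e : ∫ x, flowOp m t f x * φ x =
      ∫ x, (fun y => f y * φ (freeFlow m (-t) y)) (freeFlow m t x) := by
    refine integral_congr_ae ?_
    filter_upwards [flowOp_coeFn m t f] with x hx
    rw [hx, freeFlow_neg_freeFlow]
  rw [e]
  refine (measurePreserving_freeFlow m t).integral_comp ?_
    (fun y => f y * φ (freeFlow m (-t) y))
  refine MeasurableEmbedding.of_measurable_inverse (g := freeFlow m (-t))
    (continuous_freeFlow m t).measurable ?_ (continuous_freeFlow m (-t)).measurable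
    (freeFlow_neg_freeFlow m t)
  rw [Set.range_eq_univ.2 fun x => ⟨_, freeFlow_freeFlow_neg m t x⟩]
  exact MeasurableSet.univ

theorem hasCompactSupport_comp_freeFlow (m t : ℝ) {φ : ℝ × ℝ → ℂ} (hc : HasCompactSupport φ) :
    HasCompactSupport fun x => φ (freeFlow m t x) := by
  refine HasCompactSupport.intro (hc.isCompact.image (continuous_freeFlow m (-t))) fun x hx => ?_
  by_contra h
  exact hx ⟨freeFlow m t x, subset_closure h, freeFlow_neg_freeFlow m t x⟩

/-- The derivative `X₀ · ∇φ` along the free field. -/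
def transport (m : ℝ) (φ : ℝ × ℝ → ℂ) (x : ℝ × ℝ) : ℂ := fderiv ℝ φ x (freeField m x)

theorem contDiff_transport (m : ℝ) {φ : ℝ × ℝ → ℂ} (hφ : ContDiff ℝ ∞ φ) :
    ContDiff ℝ ∞ (transport m φ) := by
  have h1 : ContDiff ℝ ∞ (fderiv ℝ φ) := hφ.fderiv_right (by simp)
  have h2 : ContDiff ℝ ∞ (freeField m) := by unfold freeField; fun_prop
  exact h1.clm_apply h2

theorem hasCompactSupport_transport (m : ℝ) {φ : ℝ × ℝ → ℂ} (hc : HasCompactSupport φ) :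
    HasCompactSupport (transport m φ) :=
  (hc.fderiv ℝ).mono fun x hx => by
    contrapose! hx
    simp only [Function.mem_support, ne_eq, not_not] at hx ⊢
    simp [transport, hx]

theorem hasDerivAt_comp_freeFlow (m t : ℝ) {φ : ℝ × ℝ → ℂ} (hφ : ContDiff ℝ ∞ φ) (x : ℝ × ℝ) :
    HasDerivAt (fun t => φ (freeFlow m t x)) (transport m φ (freeFlow m t x)) t := by
  have h1 : HasFDerivAt φ (fderiv ℝ φ (freeFlow m t x)) (freeFlow m t x) :=
    (hφ.differentiable (by simp) _).hasFDerivAt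
  exact h1.comp_hasDerivAt t (hasDerivAt_freeFlow m t x)

/-- A vector field commutes with its own flow: both sides are derivatives at `0` of `s ↦ φ (Φ_{s+t}
x)`. -/
theorem transport_comp_freeFlow (m t : ℝ) {φ : ℝ × ℝ → ℂ} (hφ : ContDiff ℝ ∞ φ) (x : ℝ × ℝ) :
    transport m (fun x => φ (freeFlow m t x)) x = transport m φ (freeFlow m t x) := by
  have h1 := hasDerivAt_comp_freeFlow m 0 (hφ.comp (contDiff_freeFlow m t)) x
  have h2 := hasDerivAt_comp_freeFlow m (0 + t) hφ x
  have h3 := h2.comp_add_const 0 t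
  rw [freeFlow_zero, zero_add] at *
  refine h1.unique ?_
  convert h3 using 2 with s
  simp [freeFlow_freeFlow, add_comm]

theorem hasDerivAt_integral_mul_comp_freeFlow (m t : ℝ) (f : PhaseL2) {φ : ℝ × ℝ → ℂ}
    (hφ : ContDiff ℝ ∞ φ) (hc : HasCompactSupport φ) :
    HasDerivAt (fun t => ∫ x, f x * φ (freeFlow m t x))
      (∫ x, f x * transport m φ (freeFlow m t x)) t := by
  obtain ⟨C, hC⟩ := (hasCompactSupport_transport m hc).exists_bound_of_continuous
    (contDiff_transport m hφ).continuous
  -- The compact set swept out by the support of `X₀ · ∇φ` under the backward flow; it carries the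
  -- integrands for all times within `1` of `t`.
  let K : Set (ℝ × ℝ) := (fun y : ℝ × (ℝ × ℝ) => freeFlow m y.1 y.2) ''
    (Set.Icc (-(t + 1)) (-(t - 1)) ×ˢ tsupport (transport m φ))
  have hK : IsCompact K := (isCompact_Icc.prod (hasCompactSupport_transport m hc).isCompact).image
    (continuous_freeFlow_uncurry m)
  have hfK : IntegrableOn (f : ℝ × ℝ → ℂ) K :=
    ((Lp.memLp f).locallyIntegrable (by norm_num)).integrableOn_isCompact hK
  have hfm : AEStronglyMeasurable (f : ℝ × ℝ → ℂ) volume := Lp.aestronglyMeasurable f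
  refine (hasDerivAt_integral_of_dominated_loc_of_deriv_le
    (s := Set.Ioo (t - 1) (t + 1)) (bound := K.indicator fun x => ‖f x‖ * C)
    (F := fun t x => f x * φ (freeFlow m t x))
    (F' := fun t x => f x * transport m φ (freeFlow m t x))
    (Ioo_mem_nhds (by linarith) (by linarith)) ?_ ?_ ?_ ?_ ?_ ?_).2
  · exact Filter.Eventually.of_forall fun s => hfm.mul
      (hφ.continuous.comp (continuous_freeFlow m s)).aestronglyMeasurable
  · exact integrable_mul_of_hasCompactSupport f (hφ.continuous.comp (continuous_freeFlow m t))
      (hasCompactSupport_comp_freeFlow m t hc)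
  · exact hfm.mul ((contDiff_transport m hφ).continuous.comp
      (continuous_freeFlow m t)).aestronglyMeasurable
  · refine Filter.Eventually.of_forall fun x s hs => ?_
    by_cases hx : transport m φ (freeFlow m s x) = 0
    · rw [hx, mul_zero, norm_zero]
      refine Set.indicator_nonneg (fun y _ => ?_) x
      exact mul_nonneg (norm_nonneg _) ((norm_nonneg _).trans (hC y))
    · have hxK : x ∈ K := ⟨(-s, freeFlow m s x), ⟨⟨by linarith [hs.2], by linarith [hs.1]⟩,
        subset_closure hx⟩, freeFlow_neg_freeFlow m s x⟩
      rw [Set.indicator_of_mem hxK, norm_mul]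
      gcongr
      exact hC _
  · rw [integrable_indicator_iff hK.measurableSet]
    exact hfK.norm.mul_const C
  · exact Filter.Eventually.of_forall fun x s _ =>
      (hasDerivAt_comp_freeFlow m s hφ x).const_mul (f x)

/-- The weak equation is tested against `φ ∘ Φ_t`, which moves the time derivative from the test
function to `f`. -/
theorem HasWeakTransport.hasDerivAt {m : ℝ} {f h : PhaseL2} (H : HasWeakTransport m f h) (t : ℝ)
    {φ : ℝ × ℝ → ℂ} (hφ : ContDiff ℝ ∞ φ) (hc : HasCompactSupport φ) :
    HasDerivAt (fun t => ∫ x, f x * φ (freeFlow m t x))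
      (-∫ x, h x * φ (freeFlow m t x)) t := by
  rw [← H (fun x => φ (freeFlow m t x)) (hφ.comp (contDiff_freeFlow m t))
    (hasCompactSupport_comp_freeFlow m t hc)]
  convert hasDerivAt_integral_mul_comp_freeFlow m t f hφ hc using 4 with x
  exact transport_comp_freeFlow m t hφ x

/-- The class in `L²` of a continuous function with compact support. -/
def testLp {φ : ℝ × ℝ → ℂ} (hφ : Continuous φ) (hc : HasCompactSupport φ) : PhaseL2 :=
  (hφ.memLp_of_hasCompactSupport hc).toLp φ

theorem testLp_coeFn {φ : ℝ × ℝ → ℂ} (hφ : Continuous φ) (hc : HasCompactSupport φ) :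
    testLp hφ hc =ᵐ[volume] φ :=
  MemLp.coeFn_toLp _

/-- Integration by parts for test functions, obtained by differentiating `∫ φ · (ψ ∘ Φ_t) = ∫ (φ ∘
Φ_{-t}) · ψ` at `t = 0`. -/
theorem hasWeakTransport_testLp (m : ℝ) {φ : ℝ × ℝ → ℂ} (hφ : ContDiff ℝ ∞ φ)
    (hc : HasCompactSupport φ) :
    HasWeakTransport m (testLp hφ.continuous hc)
      (testLp (contDiff_transport m hφ).continuous (hasCompactSupport_transport m hc)) := by
  intro ψ hψ hcψ
  have h1 := hasDerivAt_integral_mul_comp_freeFlow m 0 (testLp hφ.continuous hc) hψ hcψ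
  have h2 := (hasDerivAt_integral_mul_comp_freeFlow m (-0) (testLp hψ.continuous hcψ)
    hφ hc).scomp 0 (hasDerivAt_neg 0)
  have e : (fun t => ∫ x, testLp hψ.continuous hcψ x * φ (freeFlow m t x)) ∘ Neg.neg =
      fun t => ∫ x, testLp hφ.continuous hc x * ψ (freeFlow m t x) := by
    funext t
    rw [Function.comp_apply, ← integral_flowOp_mul]
    refine integral_congr_ae ?_
    filter_upwards [flowOp_coeFn m t (testLp hψ.continuous hcψ), testLp_coeFn hφ.continuous hc,
      (measurePreserving_freeFlow m t).quasiMeasurePreserving.ae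
        (testLp_coeFn hψ.continuous hcψ)] with x a b c
    rw [a, b, c, mul_comm]
  rw [e] at h2
  have h3 := h1.unique h2
  rw [neg_zero, neg_smul, one_smul] at h3
  simp only [freeFlow_zero] at h3
  refine h3.trans (congrArg _ (integral_congr_ae ?_))
  filter_upwards [testLp_coeFn hψ.continuous hcψ, testLp_coeFn
    (contDiff_transport m hφ).continuous (hasCompactSupport_transport m hc)] with x a b
  rw [a, b, mul_comm]

end Flow

/-! ### The free operator and weak derivatives -/

section FreeOperator

theorem HasWeakTransport.mem_domain {m : ℝ} {f h : PhaseL2} (H : HasWeakTransport m f h) :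
    ∃ hf : f ∈ (freeOp m).domain, freeOp m ⟨f, hf⟩ = -I • h := by
  have h1 : (f, -I • h) ∈ (freeOp m).graph := by
    rw [freeOp_graph]
    exact ⟨h, H, rfl⟩
  obtain ⟨y, hy1, hy2⟩ := (LinearPMap.mem_graph_iff _).1 h1
  simp only at hy1 hy2
  subst hy1
  exact ⟨y.2, hy2⟩

theorem hasWeakTransport_freeOp {m : ℝ} (u : (freeOp m).domain) :
    HasWeakTransport m (u : PhaseL2) (I • freeOp m u) := by
  have h1 : ((u : PhaseL2), freeOp m u) ∈ (freeOp m).graph := LinearPMap.mem_graph _ u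
  rw [freeOp_graph] at h1
  obtain ⟨h, H, e⟩ := h1
  simp only at H e
  rw [e, smul_smul]
  simpa using H

end FreeOperator

/-! ### Pairing with test functions -/

section TestPairing

/-- The continuous functional `f ↦ ∫ f φ`, for `φ` continuous with compact support. -/
def testPairing {φ : ℝ × ℝ → ℂ} (hφ : Continuous φ) (hc : HasCompactSupport φ) :
    PhaseL2 →L[ℂ] ℂ :=
  innerSL ℂ (testLp (φ := fun x => conj (φ x)) (by fun_prop) (hc.comp_left (map_zero _)))

theorem testPairing_apply {φ : ℝ × ℝ → ℂ} (hφ : Continuous φ) (hc : HasCompactSupport φ)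
    (f : PhaseL2) : testPairing hφ hc f = ∫ x, f x * φ x := by
  rw [testPairing, innerSL_apply_apply, L2.inner_def]
  refine integral_congr_ae ?_
  filter_upwards [testLp_coeFn (φ := fun x => conj (φ x)) (by fun_prop)
    (hc.comp_left (map_zero _))] with x hx
  rw [hx]
  simp

theorem eq_zero_of_testPairing {f : PhaseL2} (h : ∀ (φ : ℝ × ℝ → ℂ) (hφ : ContDiff ℝ ∞ φ)
    (hc : HasCompactSupport φ), testPairing hφ.continuous hc f = 0) : f = 0 := by
  -- Vanishing pairings say that `f` is a weak derivative of `0`, for any mass; the value `1` is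
  -- arbitrary.
  refine HasWeakTransport.eq_zero (m := 1) fun φ hφ hc => ?_
  rw [← testPairing_apply hφ.continuous hc f, h φ hφ hc, neg_zero]
  refine integral_eq_zero_of_ae ?_
  filter_upwards [Lp.coeFn_zero ℂ 2 (volume : Measure (ℝ × ℝ))] with x hx
  rw [hx]
  simp

theorem testPairing_flowOp_neg (m t : ℝ) {φ : ℝ × ℝ → ℂ} (hφ : Continuous φ)
    (hc : HasCompactSupport φ) (f : PhaseL2) :
    testPairing hφ hc (flowOp m (-t) f) = ∫ x, f x * φ (freeFlow m t x) := by
  rw [testPairing_apply, integral_flowOp_mul, neg_neg]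

end TestPairing

/-! ### The free resolvent as a Laplace transform -/

section LaplaceTransform

/-- The sign of the imaginary part. -/
def imSign (z : ℂ) : ℝ := SignType.sign z.im

theorem coe_imSign (z : ℂ) : ((imSign z : ℝ) : ℂ) = (SignType.sign z.im : ℂ) := by
  unfold imSign
  cases SignType.sign z.im <;> simp

theorem imSign_mul_im (z : ℂ) : imSign z * z.im = |z.im| := by
  unfold imSign
  exact sign_mul_self z.im

theorem imSign_eq_one_or {z : ℂ} (hz : z.im ≠ 0) : imSign z = 1 ∨ imSign z = -1 := by
  unfold imSign
  rcases lt_or_gt_of_ne hz with h | h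
  · right; simp [sign_neg h]
  · left; simp [sign_pos h]

theorem imSign_mul_self {z : ℂ} (hz : z.im ≠ 0) : imSign z * imSign z = 1 := by
  rcases imSign_eq_one_or hz with h | h <;> rw [h] <;> norm_num

theorem imSign_conj (z : ℂ) : imSign (conj z) = -imSign z := by
  unfold imSign
  rw [conj_im, Left.sign_neg]
  cases SignType.sign z.im <;> simp

/-- The exponential `exp (i s z t)`, with `s` the sign of `Im z`; it decays for `t → ∞`. -/
def decay (z : ℂ) (t : ℝ) : ℂ := exp (I * imSign z * z * t)

theorem norm_decay (z : ℂ) (t : ℝ) : ‖decay z t‖ = Real.exp (-|z.im| * t) := by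
  rw [decay, Complex.norm_exp, ← imSign_mul_im]
  congr 1
  simp

theorem continuous_decay (z : ℂ) : Continuous (decay z) := by
  unfold decay; fun_prop

theorem decay_zero (z : ℂ) : decay z 0 = 1 := by simp [decay]

theorem hasDerivAt_decay (z : ℂ) (t : ℝ) :
    HasDerivAt (decay z) (I * imSign z * z * decay z t) t := by
  unfold decay
  have h := ((hasDerivAt_id (t : ℂ)).const_mul (I * imSign z * z)).cexp.comp_ofReal
  simpa [mul_comm] using h

theorem integrableOn_exp_neg_abs {z : ℂ} (hz : z.im ≠ 0) :
    IntegrableOn (fun t : ℝ => Real.exp (-|z.im| * t)) (Set.Ioi 0) :=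
  integrableOn_exp_mul_Ioi (by simpa using hz) 0

theorem integrableOn_decay_smul {E : Type*} [NormedAddCommGroup E] [NormedSpace ℂ E]
    {z : ℂ} (hz : z.im ≠ 0) {g : ℝ → E} (hg : Continuous g) {C : ℝ} (hC : ∀ t, ‖g t‖ ≤ C) :
    IntegrableOn (fun t => decay z t • g t) (Set.Ioi 0) := by
  refine ((integrableOn_exp_neg_abs hz).mul_const C).mono'
    ((continuous_decay z).smul hg).aestronglyMeasurable
    (Filter.Eventually.of_forall fun t => ?_)
  rw [norm_smul, norm_decay]
  gcongr
  exact hC t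

theorem integrableOn_decay_flowOp (m : ℝ) {z : ℂ} (hz : z.im ≠ 0) (v : PhaseL2) :
    IntegrableOn (fun t => decay z t • flowOp m (-(imSign z * t)) v) (Set.Ioi 0) :=
  integrableOn_decay_smul hz ((continuous_flowOp m v).comp (by fun_prop : Continuous
    fun t : ℝ => -(imSign z * t))) fun _ => ((flowOp m _).norm_map v).le

/-- The Laplace transform of the free flow, which is the free resolvent. -/
def laplaceOp (m : ℝ) {z : ℂ} (hz : z.im ≠ 0) : PhaseL2 →L[ℂ] PhaseL2 :=
  LinearMap.mkContinuous
    { toFun := fun v => (imSign z * I) •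
        ∫ t in Set.Ioi (0 : ℝ), decay z t • flowOp m (-(imSign z * t)) v
      map_add' := fun v w => by
        rw [← smul_add, ← integral_add (integrableOn_decay_flowOp m hz v)
          (integrableOn_decay_flowOp m hz w)]
        simp only [map_add, smul_add]
      map_smul' := fun c v => by
        rw [RingHom.id_apply, smul_comm c, ← integral_smul c]
        simp only [map_smul, smul_comm c] }
    |z.im|⁻¹
    (fun v => by
      rw [LinearMap.coe_mk, AddHom.coe_mk, norm_smul]
      have h1 : ‖(imSign z * I : ℂ)‖ = 1 := by
        rcases imSign_eq_one_or hz with h | h <;> simp [h]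
      rw [h1, one_mul]
      refine (norm_integral_le_of_norm_le ((integrableOn_exp_neg_abs hz).mul_const ‖v‖)
        (Filter.Eventually.of_forall fun t => ?_)).trans (le_of_eq ?_)
      · rw [norm_smul, norm_decay, (flowOp m _).norm_map]
      · rw [integral_mul_const, integral_exp_mul_Ioi (by simpa using hz)]
        simp)

theorem laplaceOp_apply (m : ℝ) {z : ℂ} (hz : z.im ≠ 0) (v : PhaseL2) :
    laplaceOp m hz v = (imSign z * I) •
        ∫ t in Set.Ioi (0 : ℝ), decay z t • flowOp m (-(imSign z * t)) v := rfl

theorem map_laplaceOp (m : ℝ) {z : ℂ} (hz : z.im ≠ 0) (v : PhaseL2) (ℓ : PhaseL2 →L[ℂ] ℂ) :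
    ℓ (laplaceOp m hz v) = (imSign z * I) *
        ∫ t in Set.Ioi (0 : ℝ), decay z t * ℓ (flowOp m (-(imSign z * t)) v) := by
  rw [laplaceOp_apply, map_smul, smul_eq_mul,
    ← ℓ.integral_comp_comm (integrableOn_decay_flowOp m hz v)]
  simp only [map_smul, smul_eq_mul]

/-- The adjoint of the flow at time `t` is the flow at time `-t`. Conjugating `z` flips `s`, so `i s
z` turns into its conjugate and the flow time `-s t` into its negative. -/
theorem inner_laplaceOp (m : ℝ) {z : ℂ} (hz : z.im ≠ 0) (v w : PhaseL2) :
    inner ℂ (laplaceOp m hz v) w = inner ℂ v (laplaceOp m (conj_im_ne_zero hz) w) := by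
  have h1 := map_laplaceOp m hz v (innerSL ℂ w)
  have h2 := map_laplaceOp m (conj_im_ne_zero hz) w (innerSL ℂ v)
  simp only [innerSL_apply_apply] at h1 h2
  rw [h2, ← inner_conj_symm, h1, map_mul, ← integral_conj]
  simp only [imSign_conj, map_mul, conj_I, conj_ofReal]
  push_cast
  congr 1
  · ring
  · refine integral_congr_ae (Filter.Eventually.of_forall fun t => ?_)
    simp only
    rw [inner_conj_symm, inner_flowOp_left]
    congr 2
    · rw [decay, decay, ← exp_conj, imSign_conj]
      simp only [map_mul, conj_I, conj_ofReal]
      push_cast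
      congr 1
      ring
    · congr 1
      ring_nf

/-- Integration by parts in the Laplace transform. -/
theorem map_laplaceOp_of_hasDerivAt (m : ℝ) {z : ℂ} (hz : z.im ≠ 0) {f g : PhaseL2}
    {ℓ ℓ' : PhaseL2 →L[ℂ] ℂ}
    (hd : ∀ t, HasDerivAt (fun t => ℓ (flowOp m (-t) f)) (ℓ' (flowOp m (-t) g)) t) :
    ℓ' (laplaceOp m hz g) = -I * ℓ (z • laplaceOp m hz f + f) := by
  set s := imSign z with hs
  have hcont : ∀ (k : PhaseL2 →L[ℂ] ℂ) (f : PhaseL2),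
      Continuous fun t : ℝ => k (flowOp m (-(s * t)) f) := fun k f =>
    k.continuous.comp ((continuous_flowOp m f).comp (by fun_prop : Continuous
      fun t : ℝ => -(s * t)))
  have hbd : ∀ (k : PhaseL2 →L[ℂ] ℂ) (f : PhaseL2) (t : ℝ),
      ‖k (flowOp m (-(s * t)) f)‖ ≤ ‖k‖ * ‖f‖ := fun k f t =>
    (k.le_opNorm _).trans (by rw [(flowOp m _).norm_map])
  have hint : ∀ (k : PhaseL2 →L[ℂ] ℂ) (f : PhaseL2), IntegrableOn
      (fun t => decay z t * k (flowOp m (-(s * t)) f)) (Set.Ioi 0) := fun k f =>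
    integrableOn_decay_smul hz (hcont k f) (hbd k f)
  have hder : ∀ t ∈ Set.Ici (0 : ℝ),
      HasDerivAt (fun t : ℝ => decay z t * ℓ (flowOp m (-(s * t)) f))
      (I * s * z * (decay z t * ℓ (flowOp m (-(s * t)) f)) +
        s * (decay z t * ℓ' (flowOp m (-(s * t)) g))) t := by
    intro t _
    have h1 := (hd (s * t)).scomp t ((hasDerivAt_id t).const_mul s)
    refine ((hasDerivAt_decay z t).mul h1).congr_deriv ?_
    simp only [mul_one, Complex.real_smul, Function.comp_apply]
    ring
  have htend : Filter.Tendsto (fun t : ℝ => decay z t * ℓ (flowOp m (-(s * t)) f)) Filter.atTop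
      (nhds 0) := by
    refine squeeze_zero_norm (a := fun t => Real.exp (-|z.im| * t) * (‖ℓ‖ * ‖f‖))
      (fun t => ?_) ?_
    · rw [norm_mul, norm_decay]
      gcongr
      exact hbd ℓ f t
    · have : Filter.Tendsto (fun t => Real.exp (-|z.im| * t)) Filter.atTop (nhds 0) := by
        refine Real.tendsto_exp_atBot.comp ?_
        exact Filter.tendsto_id.const_mul_atTop_of_neg (by simpa using hz)
      simpa using this.mul_const (‖ℓ‖ * ‖f‖)
  -- The boundary term at infinity vanishes and the one at `0` is `-ℓ f`; multiplication by `i` then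
  -- turns both integrals into values of `laplaceOp`.
  have key := integral_Ioi_of_hasDerivAt_of_tendsto' hder
    (((hint ℓ f).const_mul _).add ((hint ℓ' g).const_mul _)) htend
  rw [integral_add ((hint ℓ f).const_mul _) ((hint ℓ' g).const_mul _), integral_const_mul,
    integral_const_mul, decay_zero, mul_zero, neg_zero, one_mul] at key
  have e0 : flowOp m 0 f = f := by
    refine Lp.ext ((flowOp_coeFn m 0 f).trans ?_)
    simp only [freeFlow_zero, Filter.EventuallyEq.refl]
  rw [e0] at key
  rw [map_add, map_smul, map_laplaceOp, map_laplaceOp, smul_eq_mul, ← hs]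
  linear_combination I * key

/-- Both halves are the integration by parts above. For the right inverse the derivative falls on
the test function (`ℓ'` pairs with `X₀ · ∇φ`); for the left inverse it falls on `u` through its weak
derivative `i L₀ u`, and `ℓ' = -ℓ`. -/
theorem isResolvent_laplaceOp (m : ℝ) {z : ℂ} (hz : z.im ≠ 0) :
    IsResolvent (freeOp m) z (laplaceOp m hz) := by
  constructor
  · intro v
    have H : HasWeakTransport m (laplaceOp m hz v) (I • (z • laplaceOp m hz v + v)) := by
      intro φ hφ hc
      have h := map_laplaceOp_of_hasDerivAt m hz (f := v) (g := v)
        (ℓ := testPairing hφ.continuous hc)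
        (ℓ' := testPairing (contDiff_transport m hφ).continuous (hasCompactSupport_transport m hc))
        (fun t => by
          simp only [testPairing_flowOp_neg]
          exact hasDerivAt_integral_mul_comp_freeFlow m t v hφ hc)
      rw [testPairing_apply] at h
      refine h.trans ?_
      rw [← testPairing_apply hφ.continuous hc, map_smul, smul_eq_mul, neg_mul]
    obtain ⟨hf, e⟩ := H.mem_domain
    refine ⟨hf, ?_⟩
    rw [e, smul_smul]
    simp
  · intro u
    have H := hasWeakTransport_freeOp u
    have key : laplaceOp m hz (I • freeOp m u) = I • (z • laplaceOp m hz u + u) := by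
      rw [← sub_eq_zero]
      refine eq_zero_of_testPairing fun φ hφ hc => ?_
      have h := map_laplaceOp_of_hasDerivAt m hz (f := u) (g := I • freeOp m u)
        (ℓ := testPairing hφ.continuous hc) (ℓ' := -testPairing hφ.continuous hc)
        (fun t => by
          simp only [neg_apply, testPairing_flowOp_neg]
          exact H.hasDerivAt t hφ hc)
      rw [neg_apply] at h
      rw [map_sub, (testPairing hφ.continuous hc).map_smul I (_ + _), smul_eq_mul]
      linear_combination -h
    have e : freeOp m u - z • (u : PhaseL2) = -I • (I • freeOp m u) - z • (u : PhaseL2) := by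
      rw [smul_smul]; simp
    rw [e, map_sub, (laplaceOp m hz).map_smul (-I), (laplaceOp m hz).map_smul z, key,
      smul_smul]
    simp

theorem IsResolvent.unique {T : PhaseL2 →ₗ.[ℂ] PhaseL2} {z : ℂ} {R R' : PhaseL2 →L[ℂ] PhaseL2}
    (h : IsResolvent T z R) (h' : IsResolvent T z R') : R = R' := by
  ext1 f
  obtain ⟨hf, e⟩ := h.1 f
  have := h'.2 ⟨R f, hf⟩
  rw [e] at this
  exact this.symm

theorem isResolvent_freeResolvent (m : ℝ) {z : ℂ} (hz : z.im ≠ 0) :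
    IsResolvent (freeOp m) z (freeResolvent m z) := by
  have h : ∃ R, IsResolvent (freeOp m) z R := ⟨_, isResolvent_laplaceOp m hz⟩
  rw [freeResolvent, dif_pos h]
  exact h.choose_spec

theorem freeResolvent_eq_laplaceOp (m : ℝ) {z : ℂ} (hz : z.im ≠ 0) :
    freeResolvent m z = laplaceOp m hz :=
  (isResolvent_freeResolvent m hz).unique (isResolvent_laplaceOp m hz)

theorem inner_freeResolvent (m : ℝ) {z : ℂ} (hz : z.im ≠ 0) (v w : PhaseL2) :
    inner ℂ (freeResolvent m z v) w = inner ℂ v (freeResolvent m (conj z) w) := by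
  rw [freeResolvent_eq_laplaceOp m hz, freeResolvent_eq_laplaceOp m (conj_im_ne_zero hz),
    inner_laplaceOp]

theorem isSelfAdjoint_freeOp (m : ℝ) : IsSelfAdjoint (freeOp m) := by
  have hI : I.im ≠ 0 := by simp
  exact isSelfAdjoint_of_isResolvent (isResolvent_freeResolvent m hI)
    (isResolvent_freeResolvent m (conj_im_ne_zero hI)) (inner_freeResolvent m hI)

end LaplaceTransform

/-! ### The weighted measures `|p|ⁿ dp` -/

section AbsMeasure

theorem ae_ne_zero_real : ∀ᵐ p : ℝ, p ≠ 0 := by simp [ae_iff, measure_singleton]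

/-- The density is positive off the null set `{0}`, so all these measures have the null sets of
`dp`. -/
theorem ae_absMeasure_iff (n : ℤ) {P : ℝ → Prop} :
    (∀ᵐ p ∂absMeasure n, P p) ↔ ∀ᵐ p : ℝ, P p := by
  rw [absMeasure, ae_withDensity_iff (by fun_prop)]
  constructor
  · intro h
    filter_upwards [h, ae_ne_zero_real] with p hp h0
    refine hp ?_
    have : 0 < |p| ^ n := zpow_pos (abs_pos.2 h0) n
    simpa using this
  · intro h
    filter_upwards [h] with p hp _ using hp

instance sigmaFinite_absMeasure (n : ℤ) : SigmaFinite (absMeasure n) := by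
  unfold absMeasure
  exact SigmaFinite.withDensity_ofReal _

theorem integral_absMeasure (n : ℤ) (f : ℝ → ℂ) :
    ∫ p, f p ∂absMeasure n = ∫ p : ℝ, ((|p| ^ n : ℝ) : ℂ) * f p := by
  rw [absMeasure, integral_withDensity_eq_integral_toReal_smul (by fun_prop)
    (Filter.Eventually.of_forall fun p => ENNReal.ofReal_lt_top)]
  refine integral_congr_ae (Filter.Eventually.of_forall fun p => ?_)
  simp only
  rw [ENNReal.toReal_ofReal (by positivity), real_smul]

theorem setIntegral_absMeasure (n : ℤ) (f : ℝ → ℂ) {s : Set ℝ} (hs : MeasurableSet s) :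
    ∫ p in s, f p ∂absMeasure n = ∫ p in s, ((|p| ^ n : ℝ) : ℂ) * f p := by
  rw [absMeasure, setIntegral_withDensity_eq_setIntegral_toReal_smul (by fun_prop)
    (Filter.Eventually.of_forall fun p => ENNReal.ofReal_lt_top) _ hs]
  refine integral_congr_ae (Filter.Eventually.of_forall fun p => ?_)
  simp only
  rw [ENNReal.toReal_ofReal (by positivity), real_smul]

theorem integrableOn_absMeasure_iff (n : ℤ) (f : ℝ → ℂ) {s : Set ℝ} (hs : MeasurableSet s) :
    IntegrableOn f s (absMeasure n) ↔ IntegrableOn (fun p : ℝ => ((|p| ^ n : ℝ) : ℂ) * f p) s := by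
  rw [IntegrableOn, absMeasure, restrict_withDensity hs,
    integrable_withDensity_iff_integrable_smul' (by fun_prop)
    (Filter.Eventually.of_forall fun p => ENNReal.ofReal_lt_top)]
  refine integrable_congr (Filter.Eventually.of_forall fun p => ?_)
  simp only
  rw [ENNReal.toReal_ofReal (by positivity), real_smul]

end AbsMeasure

/-! ### Adjoints for the duality of the weighted spaces -/

section DualAdjoint

/-- The factor `|p|⁻¹` in `dualAdjoint` is the density of `|p|⁻¹ dp`, so the Hilbert pairing becomes
the unweighted one; this confirms that `dualAdjoint` is the intended adjoint. -/
theorem integral_conj_mul_dualAdjoint (T : LineL2 (-1) →L[ℂ] PhaseL2) (φ : LineL2 (-1))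
    (f : PhaseL2) : ∫ p : ℝ, conj (φ p) * dualAdjoint T f p = inner ℂ (T φ) f := by
  rw [← ContinuousLinearMap.adjoint_inner_right, L2.inner_def, integral_absMeasure]
  refine integral_congr_ae ?_
  filter_upwards [(ae_absMeasure_iff 1).1 (weightedComp_coeFn weightBound_invAbs measurable_id
    measurable_invAbs (ContinuousLinearMap.adjoint T f))] with p hp
  rw [dualAdjoint, ContinuousLinearMap.comp_apply, hp]
  simp
  ring

theorem opG_coeFn {m : ℝ} (hm : 0 < m) {z : ℂ} (hz : z.im ≠ 0) (φ : LineL2 (-1)) :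
    opG hm hz φ =ᵐ[volume] fun x => green m z x * φ x.2 :=
  weightedComp_coeFn _ _ _ _

/-- Both sides are integrated over sets of finite measure: pairing with an indicator and Fubini give
the integral kernel, and the factor `|p|` compensates the density `|p|⁻¹`. -/
theorem adjoint_opG_coeFn {m : ℝ} (hm : 0 < m) {z : ℂ} (hz : z.im ≠ 0) (f : PhaseL2) :
    ContinuousLinearMap.adjoint (opG hm hz) f =ᵐ[absMeasure (-1)]
      fun p => |p| * ∫ q, conj (green m z (q, p)) * f (q, p) := by
  have key : ∀ s, MeasurableSet s → absMeasure (-1) s < ⊤ →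
      IntegrableOn (fun p => ∫ q, conj (green m z (q, p)) * f (q, p)) s ∧
      ∫ p in s, ContinuousLinearMap.adjoint (opG hm hz) f p ∂absMeasure (-1) =
        ∫ p in s, ∫ q, conj (green m z (q, p)) * f (q, p) := by
    intro s hs hμ
    let φ : LineL2 (-1) := indicatorConstLp 2 hs hμ.ne (1 : ℂ)
    have hG : opG hm hz φ =ᵐ[volume] fun x => green m z x * s.indicator (fun _ => (1 : ℂ)) x.2 :=
      (opG_coeFn hm hz φ).trans ((weightBound_green hm hz).ae_eq measurable_snd
        (measurable_green m z) indicatorConstLp_coeFn)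
    have hae : (fun x => inner ℂ (opG hm hz φ x) (f x)) =ᵐ[volume] fun x : ℝ × ℝ =>
        s.indicator (fun _ => (1 : ℂ)) x.2 * (conj (green m z x) * f x) := by
      filter_upwards [hG] with x hx
      rw [hx]
      by_cases h : x.2 ∈ s <;> simp [h, mul_comm]
    have hint : Integrable (fun x : ℝ × ℝ =>
        s.indicator (fun _ => (1 : ℂ)) x.2 * (conj (green m z x) * f x))
        ((volume : Measure ℝ).prod volume) :=
      (L2.integrable_inner (opG hm hz φ) f).congr hae
    have hind : ∀ p : ℝ, (∫ q, s.indicator (fun _ => (1 : ℂ)) p *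
        (conj (green m z (q, p)) * f (q, p))) =
        s.indicator (fun p => ∫ q, conj (green m z (q, p)) * f (q, p)) p := by
      intro p
      by_cases h : p ∈ s <;> simp [h]
    constructor
    · have h1 := hint.integral_prod_right
      simp only [hind] at h1
      exact (integrable_indicator_iff hs).1 h1
    · have h1 : inner ℂ φ (ContinuousLinearMap.adjoint (opG hm hz) f) =
          ∫ p in s, ContinuousLinearMap.adjoint (opG hm hz) f p ∂absMeasure (-1) := by
        rw [L2.inner_indicatorConstLp_one]
      rw [← h1, ContinuousLinearMap.adjoint_inner_right, L2.inner_def, integral_congr_ae hae,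
        ← integral_indicator hs]
      refine (integral_prod_symm _ hint).trans ?_
      simp only [hind]
  have hcancel : ∀ᵐ p : ℝ, ((|p| ^ (-1 : ℤ) : ℝ) : ℂ) * (|p| *
      ∫ q, conj (green m z (q, p)) * f (q, p)) = ∫ q, conj (green m z (q, p)) * f (q, p) := by
    filter_upwards [ae_ne_zero_real] with p hp
    have : ((|p| : ℝ) : ℂ) ≠ 0 := by simpa using hp
    rw [zpow_neg_one, ← mul_assoc]
    push_cast
    rw [inv_mul_cancel₀ this, one_mul]
  refine ae_eq_of_forall_setIntegral_eq_of_sigmaFinite (fun s hs hμ => ?_) (fun s hs hμ => ?_)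
    fun s hs hμ => ?_
  · exact integrableOn_Lp_of_measure_ne_top _ (by norm_num) hμ.ne
  · rw [integrableOn_absMeasure_iff _ _ hs]
    exact (key s hs hμ).1.congr (ae_restrict_of_ae (hcancel.mono fun p hp => hp.symm))
  · rw [(key s hs hμ).2, setIntegral_absMeasure _ _ hs]
    exact integral_congr_ae (ae_restrict_of_ae (hcancel.mono fun p hp => hp.symm))

theorem dualAdjoint_opG_coeFn {m : ℝ} (hm : 0 < m) {z : ℂ} (hz : z.im ≠ 0) (f : PhaseL2) :
    dualAdjoint (opG hm hz) f =ᵐ[absMeasure 1]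
      fun p => ∫ q, conj (green m z (q, p)) * f (q, p) := by
  have h := (ae_absMeasure_iff 1).2 ((ae_absMeasure_iff (-1)).1 (adjoint_opG_coeFn hm hz f))
  filter_upwards [weightedComp_coeFn weightBound_invAbs measurable_id
    measurable_invAbs (ContinuousLinearMap.adjoint (opG hm hz) f), h,
    (ae_absMeasure_iff 1).2 ae_ne_zero_real] with p h1 h2 h3
  have : ((|p| : ℝ) : ℂ) ≠ 0 := by simpa using h3
  rw [dualAdjoint, ContinuousLinearMap.comp_apply, h1, id, h2]
  push_cast
  rw [inv_mul_cancel_left₀ this]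

end DualAdjoint

/-! ### The free resolvent as convolution with the Green function -/

section GreenConvolution

/-- This identifies the kernel of `G_z^*` with that of the convolution with `g_{z̄}` at `q = 0`,
which is how the trace enters. -/
theorem conj_green (m : ℝ) (z : ℂ) (q p : ℝ) :
    conj (green m z (q, p)) = green m (conj z) (-q, p) := by
  have e : (0 < -q * p * (conj z).im) = (0 < q * p * z.im) := by
    rw [conj_im]; congr 1; ring
  simp only [green, e, ← coe_imSign, imSign_conj, map_mul, map_div₀, conj_I, conj_ofReal,
    ← exp_conj, apply_ite (starRingEnd ℂ), map_one, map_zero]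
  push_cast
  have e2 : -I * m * conj z * q / p = I * m * conj z * -q / p := by ring
  rw [e2]
  ring

/-- Convolution in `q` with the Green function, written as an integral along the flow. -/
theorem integral_green_mul {m : ℝ} (hm : 0 < m) {z : ℂ} (hz : z.im ≠ 0) (w : ℝ → ℂ) (q : ℝ) {p : ℝ}
    (hp : p ≠ 0) :
    ∫ q', green m z (q - q', p) * w q' =
      (imSign z * I) * ∫ t in Set.Ioi (0 : ℝ), decay z t * w (q + -(imSign z * t) * (p / m)) := by
  have hp' : 0 < |p| := abs_pos.2 hp
  have hs := imSign_mul_self hz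
  have hs0 : imSign z ≠ 0 := fun h => by simp [h] at hs
  have hsabs : |imSign z| = 1 := by
    rcases imSign_eq_one_or hz with h | h <;> simp [h]
  have hz' : 0 < |z.im| := abs_pos.2 hz
  -- Substituting `y = a t` turns the support condition on `g_z` into `t > 0` and its exponent into
  -- `i s z t`; the Jacobian `|p| / m` cancels the prefactor `m / |p|`.
  set a : ℝ := imSign z * p / m with ha
  have ha0 : a ≠ 0 := by positivity
  have haabs : |a| = |p| / m := by
    rw [ha, abs_div, abs_mul, hsabs, one_mul, abs_of_pos hm]
  have e1 : ∫ q', green m z (q - q', p) * w q' = ∫ y, green m z (y, p) * w (q - y) := by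
    rw [← integral_sub_left_eq_self (fun y => green m z (y, p) * w (q - y)) volume q]
    simp
  have e2 := Measure.integral_comp_mul_left (fun y => green m z (y, p) * w (q - y)) a
  have e3 : ∀ t : ℝ, green m z (a * t, p) * w (q - a * t) = (Set.Ioi (0 : ℝ)).indicator
      (fun t => (imSign z * I * m / |p|) *
        (decay z t * w (q + -(imSign z * t) * (p / m)))) t := by
    intro t
    have hsgn : a * t * p * z.im = (|z.im| * (p * p) / m) * t := by
      rw [ha, ← imSign_mul_im]; field_simp
    have hpos : 0 < |z.im| * (p * p) / m := by
      have := mul_self_pos.2 hp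
      positivity
    have hiff : 0 < a * t * p * z.im ↔ 0 < t := by
      rw [hsgn]; exact mul_pos_iff_of_pos_left hpos
    have hw : q - a * t = q + -(imSign z * t) * (p / m) := by rw [ha]; ring
    by_cases ht : 0 < t
    · rw [Set.indicator_of_mem (show t ∈ Set.Ioi (0 : ℝ) from ht), green, ← coe_imSign]
      simp only [hiff, ht, if_true]
      rw [hw, decay]
      have : I * m * z * ((a * t : ℝ) : ℂ) / p = I * imSign z * z * t := by
        rw [ha]
        have hpc : (p : ℂ) ≠ 0 := by exact_mod_cast hp
        have hmc : (m : ℂ) ≠ 0 := by exact_mod_cast hm.ne'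
        push_cast
        field_simp
      rw [this]
      ring
    · rw [Set.indicator_of_notMem (show t ∉ Set.Ioi (0 : ℝ) from ht), green]
      simp only [hiff, ht, if_false]
      ring
  have e4 : ∫ y, green m z (y, p) * w (q - y) =
      (|a| : ℝ) • ∫ t, green m z (a * t, p) * w (q - a * t) := by
    rw [e2, smul_smul, abs_inv, mul_inv_cancel₀ (abs_pos.2 ha0).ne', one_smul]
  rw [e1, e4]
  simp only [e3]
  rw [integral_indicator measurableSet_Ioi, integral_const_mul, haabs, real_smul]
  have hpc : ((|p| : ℝ) : ℂ) ≠ 0 := by exact_mod_cast hp'.ne'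
  have hmc : (m : ℂ) ≠ 0 := by exact_mod_cast hm.ne'
  push_cast
  generalize (∫ t in Set.Ioi (0 : ℝ), decay z t * w (q + -(imSign z * t) * (p / m))) = J
  field_simp

/-- The convolution in `q` with the Green function. -/
def greenConv (m : ℝ) (z : ℂ) (v : PhaseL2) (x : ℝ × ℝ) : ℂ :=
  ∫ q', green m z (x.1 - q', x.2) * v (q', x.2)

/-- The Fubini hypothesis for `laplaceOp_coeFn`. Since `|v| ≤ 1 + |v|²` and the flow preserves `∫
|v|²`, the integral over `s` is bounded uniformly in time, and the exponential is integrable. -/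
theorem integrable_decay_mul_flow (m : ℝ) {z : ℂ} (hz : z.im ≠ 0) (v : PhaseL2)
    {s : Set (ℝ × ℝ)} (hμ : volume s < ⊤) :
    Integrable (fun y : ℝ × (ℝ × ℝ) => decay z y.1 * v (freeFlow m (-(imSign z * y.1)) y.2))
      ((volume.restrict (Set.Ioi 0)).prod (volume.restrict s)) := by
  have hv : Measurable (v : ℝ × ℝ → ℂ) := (Lp.stronglyMeasurable v).measurable
  have hsq : Integrable (fun x => ‖v x‖ ^ 2) :=
    (memLp_two_iff_integrable_sq_norm (Lp.aestronglyMeasurable v)).1 (Lp.memLp v)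
  have hsqt : ∀ t, Integrable (fun x => ‖v (freeFlow m t x)‖ ^ 2) := fun t =>
    (measurePreserving_freeFlow m t).integrable_comp_of_integrable hsq
  have hit : ∀ t, ∫ x, ‖v (freeFlow m t x)‖ ^ 2 = ∫ x, ‖v x‖ ^ 2 := fun t => by
    have h := integral_map (μ := volume) (continuous_freeFlow m t).measurable.aemeasurable
      (f := fun x => ‖v x‖ ^ 2) (by
        rw [(measurePreserving_freeFlow m t).map_eq]; exact hsq.aestronglyMeasurable)
    rw [(measurePreserving_freeFlow m t).map_eq] at h
    exact h.symm
  have : IsFiniteMeasure (volume.restrict s) := ⟨by simpa using hμ⟩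
  have hone : ∀ t, Integrable (fun x => v (freeFlow m t x)) (volume.restrict s) := fun t =>
    (((Lp.memLp v).comp_measurePreserving (measurePreserving_freeFlow m t)).restrict s).integrable
      (by norm_num)
  have hmeas : Measurable (fun y : ℝ × (ℝ × ℝ) =>
      decay z y.1 * v (freeFlow m (-(imSign z * y.1)) y.2)) := by
    refine ((continuous_decay z).measurable.comp measurable_fst).mul (hv.comp ?_)
    exact ((continuous_freeFlow_uncurry m).comp
      (by fun_prop : Continuous fun y : ℝ × (ℝ × ℝ) => (-(imSign z * y.1), y.2))).measurable
  rw [integrable_prod_iff hmeas.aestronglyMeasurable]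
  refine ⟨Filter.Eventually.of_forall fun t => (hone (-(imSign z * t))).const_mul (decay z t), ?_⟩
  refine ((integrableOn_exp_neg_abs hz).mul_const
    ((volume.restrict s).real Set.univ + ∫ x, ‖v x‖ ^ 2)).mono'
    hmeas.norm.stronglyMeasurable.integral_prod_right'.aestronglyMeasurable
    (Filter.Eventually.of_forall fun t => ?_)
  simp only [norm_mul, norm_decay]
  rw [integral_const_mul, norm_mul, Real.norm_of_nonneg (Real.exp_nonneg _),
    Real.norm_of_nonneg (integral_nonneg fun _ => norm_nonneg _)]
  gcongr
  calc ∫ x in s, ‖v (freeFlow m (-(imSign z * t)) x)‖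
      ≤ ∫ x in s, (1 + ‖v (freeFlow m (-(imSign z * t)) x)‖ ^ 2) := by
        refine integral_mono (hone _).norm ((integrable_const 1).add (hsqt _).integrableOn)
          fun x => ?_
        simp only
        nlinarith [sq_nonneg (‖v (freeFlow m (-(imSign z * t)) x)‖ - 1),
          norm_nonneg (v (freeFlow m (-(imSign z * t)) x))]
    _ ≤ _ := by
        rw [integral_add (integrable_const 1) (hsqt _).integrableOn, integral_const,
          smul_eq_mul, mul_one, ← hit (-(imSign z * t))]
        exact add_le_add le_rfl (setIntegral_le_integral (hsqt _)
          (Filter.Eventually.of_forall fun _ => by positivity))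

/-- The `L²`-valued integral and the pointwise one have equal integrals over every set of finite
measure, by Fubini; `integral_green_mul` rewrites the latter as a convolution. -/
theorem laplaceOp_coeFn {m : ℝ} (hm : 0 < m) {z : ℂ} (hz : z.im ≠ 0) (v : PhaseL2) :
    laplaceOp m hz v =ᵐ[volume] greenConv m z v := by
  have hF : (fun x : ℝ × ℝ => (imSign z * I) * ∫ t in Set.Ioi (0 : ℝ),
      decay z t * v (freeFlow m (-(imSign z * t)) x)) =ᵐ[volume] greenConv m z v := by
    have h0 : ∀ᵐ x : ℝ × ℝ, x.2 ≠ 0 :=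
      Measure.quasiMeasurePreserving_snd.ae ae_ne_zero_real
    filter_upwards [h0] with x hx
    rw [greenConv, integral_green_mul hm hz (fun q' => v (q', x.2)) x.1 hx]
    rfl
  refine Filter.EventuallyEq.trans ?_ hF
  refine ae_eq_of_forall_setIntegral_eq_of_sigmaFinite (fun s hs hμ => ?_) (fun s hs hμ => ?_)
    fun s hs hμ => ?_
  · exact integrableOn_Lp_of_measure_ne_top _ (by norm_num) hμ.ne
  · exact (integrable_decay_mul_flow m hz v hμ).integral_prod_right.const_mul _
  · have h1 := map_laplaceOp m hz v (innerSL ℂ (indicatorConstLp 2 hs hμ.ne (1 : ℂ)))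
    simp only [innerSL_apply_apply, L2.inner_indicatorConstLp_one] at h1
    rw [h1, integral_const_mul]
    congr 1
    rw [← integral_integral_swap (integrable_decay_mul_flow m hz v hμ)]
    refine integral_congr_ae (Filter.Eventually.of_forall fun t => ?_)
    simp only
    rw [integral_const_mul]
    congr 1
    exact integral_congr_ae (ae_restrict_of_ae (flowOp_coeFn m _ v))

theorem memLp_green {m : ℝ} (hm : 0 < m) {z : ℂ} (hz : z.im ≠ 0) {p : ℝ} (hp : p ≠ 0) :
    MemLp (fun q => green m z (q, p)) 2 volume := by
  have hg : Measurable fun q => green m z (q, p) := (measurable_green m z).comp (by fun_prop)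
  have hz' : 0 < |z.im| := abs_pos.mpr hz
  have hp' : 0 < |p| := abs_pos.mpr hp
  rw [memLp_two_iff_integrable_sq_norm hg.aestronglyMeasurable]
  refine ⟨(hg.norm.pow_const 2).aestronglyMeasurable, ?_⟩
  rw [hasFiniteIntegral_iff_enorm]
  calc ∫⁻ q, ‖‖green m z (q, p)‖ ^ 2‖ₑ
      ≤ ∫⁻ q, ENNReal.ofReal (m ^ 2 / p ^ 2) *
        ENNReal.ofReal (Real.exp (-(2 * m * |z.im| / |p|) * |q|)) := by
        refine lintegral_mono fun q => ?_
        simp only [enorm_pow, enorm_norm]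
        exact enorm_green_le hm q p hp
    _ < ⊤ := by
        rw [lintegral_const_mul _ (by fun_prop), lintegral_exp_neg_mul_abs (by positivity)]
        exact ENNReal.mul_lt_top ENNReal.ofReal_lt_top ENNReal.ofReal_lt_top

/-- The value at `q` is the scalar product of `w` with the conjugate of `g (q - ·)`, which depends
continuously on `q` in `L²`. -/
theorem continuous_convolution_of_memLp_two {g w : ℝ → ℂ} (hg : MemLp g 2 volume)
    (hw : MemLp w 2 volume) : Continuous fun q => ∫ q', g (q - q') * w q' := by
  have hgc : MemLp (fun q => conj (g q)) 2 volume := hg.star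
  let F : ℝ → C(ℝ, ℝ) := fun q => ⟨fun q' => q - q', by fun_prop⟩
  have hF : Continuous F := ContinuousMap.continuous_of_continuous_uncurry _
    (by unfold F Function.uncurry; simp only [ContinuousMap.coe_mk]; fun_prop)
  have hmp : ∀ q, MeasurePreserving (F q) (volume : Measure ℝ) volume := fun q =>
    Measure.measurePreserving_sub_left volume q
  have hc := Continuous.compMeasurePreservingLp (f := fun _ => hgc.toLp _) continuous_const hF hmp
    (by norm_num)
  refine (hc.inner (𝕜 := ℂ) (continuous_const (y := hw.toLp w))).congr fun q => ?_
  rw [L2.inner_def]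
  refine integral_congr_ae ?_
  filter_upwards [Lp.coeFn_compMeasurePreserving (hgc.toLp _) (hmp q), hw.coeFn_toLp,
    (hmp q).quasiMeasurePreserving.ae hgc.coeFn_toLp] with q' h1 h2 h3
  rw [h1, h2, Function.comp_apply, h3]
  simp [F, mul_comm]

theorem continuous_greenConv {m : ℝ} (hm : 0 < m) {z : ℂ} (hz : z.im ≠ 0) (v : PhaseL2) :
    ∀ᵐ p : ℝ, Continuous fun q => greenConv m z v (q, p) := by
  have hsq : Integrable (fun x => ‖v x‖ ^ 2) ((volume : Measure ℝ).prod volume) :=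
    (memLp_two_iff_integrable_sq_norm (Lp.aestronglyMeasurable v)).1 (Lp.memLp v)
  filter_upwards [hsq.prod_left_ae, ae_ne_zero_real] with p h1 hp
  refine continuous_convolution_of_memLp_two (memLp_green hm hz hp)
    (w := fun q' => v (q', p)) ?_
  refine (memLp_two_iff_integrable_sq_norm ?_).2 h1
  exact ((Lp.stronglyMeasurable v).measurable.comp (by fun_prop)).aestronglyMeasurable

end GreenConvolution

/-! ### The trace map -/

section Trace

/-- The trace of `u` is `G_z^* (L₀ - conj z) u`. -/
theorem isTrace_dualAdjoint {m : ℝ} (hm : 0 < m) {z : ℂ} (hz : z.im ≠ 0)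
    (u : (freeOp m).domain) :
    IsTrace u (dualAdjoint (opG hm hz) (freeOp m u - conj z • (u : PhaseL2))) := by
  -- Because `u = R⁰_{z̄} (L₀ - z̄) u`, this convolution represents `u`.
  refine ⟨greenConv m (conj z) (freeOp m u - conj z • (u : PhaseL2)), ?_,
    continuous_greenConv hm (conj_im_ne_zero hz) _, ?_⟩
  · have h := laplaceOp_coeFn hm (conj_im_ne_zero hz) (freeOp m u - conj z • (u : PhaseL2))
    rwa [(isResolvent_laplaceOp m (conj_im_ne_zero hz)).2 u] at h
  · refine (dualAdjoint_opG_coeFn hm hz _).trans (Filter.Eventually.of_forall fun p => ?_)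
    simp only [greenConv, zero_sub, conj_green]

theorem isTrace_traceMap {m : ℝ} (hm : 0 < m) (u : (freeOp m).domain) :
    IsTrace u (traceMap m u) := by
  have hI : I.im ≠ 0 := by simp
  have h : ∃ T : (freeOp m).domain →ₗ[ℂ] LineL2 1,
      ∀ u : (freeOp m).domain, IsTrace (u : PhaseL2) (T u) :=
    ⟨(dualAdjoint (opG hm hI)).toLinearMap ∘ₗ
      ((freeOp m).toFun - conj I • (freeOp m).domain.subtype),
      fun u => isTrace_dualAdjoint hm hI u⟩
  rw [traceMap, dif_pos h]
  exact h.choose_spec u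

theorem traceMap_eq {m : ℝ} (hm : 0 < m) {z : ℂ} (hz : z.im ≠ 0) (u : (freeOp m).domain) :
    traceMap m u = dualAdjoint (opG hm hz) (freeOp m u - conj z • (u : PhaseL2)) :=
  (isTrace_traceMap hm u).unique (isTrace_dualAdjoint hm hz u)

theorem traceMap_bound {m : ℝ} (hm : 0 < m) : ∃ C : ℝ, ∀ u : (freeOp m).domain,
    ‖traceMap m u‖ ≤ C * (‖(u : PhaseL2)‖ + ‖freeOp m u‖) := by
  have hI : I.im ≠ 0 := by simp
  refine ⟨‖dualAdjoint (opG hm hI)‖, fun u => ?_⟩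
  rw [traceMap_eq hm hI u]
  refine (ContinuousLinearMap.le_opNorm _ _).trans ?_
  gcongr
  refine (norm_sub_le _ _).trans ?_
  rw [norm_smul]
  simp [add_comm]

/-- This is `G_z = (γ R⁰_{z̄})^*` with `u` in the role of `R⁰_{z̄} v`. The right side does not
depend on `z`, which is what allows different `G_z` to be compared. -/
theorem inner_opG {m : ℝ} (hm : 0 < m) {z : ℂ} (hz : z.im ≠ 0) (φ : LineL2 (-1))
    (u : (freeOp m).domain) :
    inner ℂ (opG hm hz φ) (freeOp m u - conj z • (u : PhaseL2)) =
      ∫ p : ℝ, conj (φ p) * traceMap m u p := by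
  rw [traceMap_eq hm hz u, integral_conj_mul_dualAdjoint]

end Trace

/-! ### The restriction of `L₀` to `ker γ` -/

section KernelOfTrace

theorem mem_freeOpKer_domain_iff {m : ℝ} {f : PhaseL2} :
    f ∈ (freeOpKer m).domain ↔ ∃ hf : f ∈ (freeOp m).domain, traceMap m ⟨f, hf⟩ = 0 := by
  change f ∈ (LinearMap.ker (traceMap m)).map (freeOp m).domain.subtype ⊓ (freeOp m).domain ↔ _
  simp only [Submodule.mem_inf, Submodule.mem_map, LinearMap.mem_ker, Submodule.subtype_apply]
  constructor
  · rintro ⟨⟨u, hu, rfl⟩, h⟩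
    exact ⟨h, hu⟩
  · rintro ⟨hf, h⟩
    exact ⟨⟨⟨f, hf⟩, h, rfl⟩, hf⟩

theorem freeOpKer_le_freeOp (m : ℝ) : freeOpKer m ≤ freeOp m := LinearPMap.domRestrict_le

theorem freeOp_isFormalAdjoint (m : ℝ) : (freeOp m).IsFormalAdjoint (freeOp m) := by
  have h := isSelfAdjoint_freeOp m
  have h1 := LinearPMap.adjoint_isFormalAdjoint h.dense_domain
  rwa [LinearPMap.isSelfAdjoint_def.1 h] at h1

theorem freeOpKer_isFormalAdjoint (m : ℝ) : (freeOpKer m).IsFormalAdjoint (freeOpKer m) := by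
  intro x y
  have hx := (freeOpKer_le_freeOp m).2 (x := x) (y := ⟨x, (freeOpKer_le_freeOp m).1 x.2⟩) rfl
  have hy := (freeOpKer_le_freeOp m).2 (x := y) (y := ⟨y, (freeOpKer_le_freeOp m).1 y.2⟩) rfl
  rw [hx, hy]
  exact freeOp_isFormalAdjoint m ⟨x, (freeOpKer_le_freeOp m).1 x.2⟩
    ⟨y, (freeOpKer_le_freeOp m).1 y.2⟩

theorem testLp_mem_freeOpKer {m : ℝ} (hm : 0 < m) {φ : ℝ × ℝ → ℂ} (hφ : ContDiff ℝ ∞ φ)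
    (hc : HasCompactSupport φ) (h0 : ∀ p, φ (0, p) = 0) :
    testLp hφ.continuous hc ∈ (freeOpKer m).domain := by
  obtain ⟨hf, -⟩ := (hasWeakTransport_testLp m hφ hc).mem_domain
  refine mem_freeOpKer_domain_iff.2 ⟨hf, (isTrace_traceMap hm ⟨_, hf⟩).unique ?_⟩
  refine ⟨φ, testLp_coeFn hφ.continuous hc, Filter.Eventually.of_forall fun p =>
    hφ.continuous.comp (by fun_prop), ?_⟩
  filter_upwards [Lp.coeFn_zero ℂ 2 (absMeasure 1)] with p hp
  rw [hp, h0, Pi.zero_apply]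

/-- Test functions supported off the line `q = 0` lie in `ker γ`. A vector orthogonal to them
vanishes almost everywhere off that line, which is a null set. -/
theorem dense_freeOpKer_domain {m : ℝ} (hm : 0 < m) :
    Dense ((freeOpKer m).domain : Set PhaseL2) := by
  rw [Submodule.dense_iff_topologicalClosure_eq_top,
    Submodule.topologicalClosure_eq_top_iff, Submodule.eq_bot_iff]
  intro f hf
  have hU : IsOpen {x : ℝ × ℝ | x.1 ≠ 0} := isOpen_ne_fun continuous_fst continuous_const
  have hloc : LocallyIntegrable (f : ℝ × ℝ → ℂ) volume :=
    (Lp.memLp f).locallyIntegrable (by norm_num)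
  have h1 := hU.ae_eq_zero_of_integral_contDiff_smul_eq_zero (hloc.locallyIntegrableOn _)
    fun g hg hgc hgs => by
      have hg' : ContDiff ℝ ∞ fun x => (g x : ℂ) := Complex.ofRealCLM.contDiff.comp hg
      have hgc' : HasCompactSupport fun x => (g x : ℂ) := hgc.comp_left Complex.ofReal_zero
      have hmem := testLp_mem_freeOpKer hm hg' hgc' fun p => by
        have : ((0 : ℝ), p) ∉ tsupport g := fun h => hgs h rfl
        rw [image_eq_zero_of_notMem_tsupport this, Complex.ofReal_zero]
      have h2 := (Submodule.mem_orthogonal _ _).1 hf _ hmem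
      rw [L2.inner_def] at h2
      rw [← h2]
      refine integral_congr_ae ?_
      filter_upwards [testLp_coeFn hg'.continuous hgc'] with x hx
      rw [hx]
      simp [mul_comm]
  have h2 : ∀ᵐ x : ℝ × ℝ, x.1 ≠ 0 := Measure.quasiMeasurePreserving_fst.ae ae_ne_zero_real
  refine Lp.eq_zero_iff_ae_eq_zero.2 ?_
  filter_upwards [h1, h2] with x a b using a b

/-- On the closed graph of `L₀` the trace is the continuous map `(f, g) ↦ G_z^* (g - z̄ f)`, here at
`z = i`, so its vanishing is a closed condition. -/
theorem freeOpKer_isClosed {m : ℝ} (hm : 0 < m) : (freeOpKer m).IsClosed := by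
  have hI : I.im ≠ 0 := by simp
  have e : ((freeOpKer m).graph : Set (PhaseL2 × PhaseL2)) =
      ((freeOp m).graph : Set (PhaseL2 × PhaseL2)) ∩ {x : PhaseL2 × PhaseL2 |
         dualAdjoint (opG hm hI) (x.2 - conj I • x.1) = 0} := by
    ext ⟨f, g⟩
    constructor
    · intro h
      obtain ⟨y, hy1, hy2⟩ := (LinearPMap.mem_graph_iff _).1 h
      simp only at hy1 hy2
      subst hy1 hy2
      obtain ⟨hf, h0⟩ := mem_freeOpKer_domain_iff.1 y.2
      have hx := (freeOpKer_le_freeOp m).2 (x := y) (y := ⟨y, hf⟩) rfl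
      rw [hx]
      refine ⟨LinearPMap.mem_graph _ ⟨(y : PhaseL2), hf⟩, ?_⟩
      rw [traceMap_eq hm hI] at h0
      exact h0
    · rintro ⟨h, h0⟩
      obtain ⟨y, hy1, hy2⟩ := (LinearPMap.mem_graph_iff _).1 h
      simp only at hy1 hy2
      subst hy1 hy2
      have h1 : (y : PhaseL2) ∈ (freeOpKer m).domain :=
        mem_freeOpKer_domain_iff.2 ⟨y.2, (traceMap_eq hm hI y).trans h0⟩
      have hx := (freeOpKer_le_freeOp m).2 (x := ⟨y, h1⟩) (y := y) rfl
      rw [← hx]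
      exact LinearPMap.mem_graph _ (⟨y, h1⟩ : (freeOpKer m).domain)
  rw [LinearPMap.IsClosed, e]
  refine IsClosed.inter (isSelfAdjoint_freeOp m).isClosed ?_
  exact isClosed_eq (by fun_prop) continuous_const

end KernelOfTrace

/-! ### Algebra of the operators `G_z` -/

section GreenOperators

theorem opG_congr {m : ℝ} (hm : 0 < m) {z w : ℂ} (h : z = w) (hz : z.im ≠ 0) (hw : w.im ≠ 0) :
    opG hm hz = opG hm hw := by
  subst h; rfl

/-- For opposite signs the product is `exp (c t)` with `c = i s_z (z - w)` and `Re c = -|Im z| - |Im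
w| < 0`, and its integral is `-1 / c`. -/
theorem integral_decay_mul {z w : ℂ} (hz : z.im ≠ 0)
    (hs : imSign w = -imSign z) :
    (z - w) * ∫ t in Set.Ioi (0 : ℝ), decay w t * decay z t = imSign z * I := by
  have hw : w.im ≠ 0 := by
    intro h
    have h0 : imSign w = 0 := by simp [imSign, h]
    rcases imSign_eq_one_or hz with h1 | h1 <;> rw [h0, h1] at hs <;> norm_num at hs
  have hre : (I * imSign z * (z - w)).re < 0 := by
    have h1 := imSign_mul_im z
    have h2 := imSign_mul_im w
    have h3 := abs_pos.2 hz
    have h4 := abs_pos.2 hw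
    rw [hs] at h2
    simp
    linarith
  have hne : I * imSign z * (z - w) ≠ 0 := fun h => by rw [h] at hre; simp at hre
  have e : ∀ t : ℝ, decay w t * decay z t = exp (I * imSign z * (z - w) * t) := by
    intro t
    rw [decay, decay, hs, ← exp_add]
    congr 1
    push_cast
    ring
  simp only [e]
  rw [integral_exp_mul_complex_Ioi hre]
  have hsq : (imSign z : ℂ) * imSign z = 1 := by exact_mod_cast imSign_mul_self hz
  rw [ofReal_zero, mul_zero, exp_zero, mul_div_assoc', div_eq_iff hne]
  linear_combination (-(z - w)) * hsq * I ^ 2 + (-(z - w)) * I_sq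

/-- The integral is `g_w * g_z` at `q = 0`. For `z`, `w` in the same half-plane the supports of
`g_w(-q, p)` and `g_z(q, p)` lie on opposite sides of `0` and both sides vanish; otherwise
`integral_decay_mul` applies. The factor `|p|` makes the result independent of `p`. -/
theorem integral_green_mul_green {m : ℝ} (hm : 0 < m) {z w : ℂ} (hz : z.im ≠ 0) (hw : w.im ≠ 0)
    {p : ℝ} (hp : p ≠ 0) :
    (z - w) * (|p| * ∫ q, conj (green m (conj w) (q, p)) * green m z (q, p)) =
      (imSign z - imSign w) * (I * m / 2) := by
  have e0 : ∀ q, conj (green m (conj w) (q, p)) = green m w (0 - q, p) := fun q => by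
    rw [conj_green, conj_conj, zero_sub]
  have hpc : ((|p| : ℝ) : ℂ) ≠ 0 := by simpa using hp
  have hpc' : (p : ℂ) ≠ 0 := by exact_mod_cast hp
  have hmc : (m : ℂ) ≠ 0 := by exact_mod_cast hm.ne'
  simp only [e0]
  rw [integral_green_mul hm hw (fun q => green m z (q, p)) 0 hp]
  have hzs := imSign_mul_im z
  have hz' := abs_pos.2 hz
  have hpp := mul_self_pos.2 hp
  by_cases hs : imSign w = imSign z
  · have e1 : ∀ t ∈ Set.Ioi (0 : ℝ),
        decay w t * green m z (0 + -(imSign w * t) * (p / m), p) = 0 := by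
      intro t ht
      have h1 : ¬ 0 < (0 + -(imSign w * t) * (p / m)) * p * z.im := by
        have : (0 + -(imSign w * t) * (p / m)) * p * z.im = -(|z.im| * (p * p) / m * t) := by
          rw [← hzs, hs]; ring
        rw [this]
        have : 0 < |z.im| * (p * p) / m * t := mul_pos (by positivity) ht
        linarith
      simp only [green, h1, if_false]
      ring
    rw [setIntegral_congr_fun measurableSet_Ioi e1, hs]
    simp
  · have hs' : imSign w = -imSign z := by
      rcases imSign_eq_one_or hz with h1 | h1 <;> rcases imSign_eq_one_or hw with h2 | h2 <;>
        first | exact absurd (h2.trans h1.symm) hs | simp [h1, h2]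
    have e1 : ∀ t ∈ Set.Ioi (0 : ℝ),
        decay w t * green m z (0 + -(imSign w * t) * (p / m), p) =
          (imSign z * (I * m / (|p| : ℝ))) * (decay w t * decay z t) := by
      intro t ht
      have h1 : 0 < (0 + -(imSign w * t) * (p / m)) * p * z.im := by
        have : (0 + -(imSign w * t) * (p / m)) * p * z.im = |z.im| * (p * p) / m * t := by
          rw [← hzs, hs']; ring
        rw [this]
        exact mul_pos (by positivity) ht
      simp only [green, h1, if_true, ← coe_imSign]
      have h2 : I * m * z * ((0 + -(imSign w * t) * (p / m) : ℝ) : ℂ) / p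
          = I * imSign z * z * t := by
        rw [hs']
        push_cast
        field_simp
        ring
      rw [h2, ← decay]
      ring
    rw [setIntegral_congr_fun measurableSet_Ioi e1, integral_const_mul]
    have h3 := integral_decay_mul hz hs'
    have hsq : (imSign z : ℂ) * imSign z = 1 := by exact_mod_cast imSign_mul_self hz
    rw [hs']
    generalize (∫ t in Set.Ioi (0 : ℝ), decay w t * decay z t) = J at h3 ⊢
    push_cast
    field_simp
    linear_combination (-2 * (imSign z : ℂ) ^ 2) * I * h3 - 2 * (imSign z : ℂ) ^ 3 * I_sq +
      2 * (imSign z : ℂ) * hsq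

theorem adjoint_opG_opG {m : ℝ} (hm : 0 < m) {z w : ℂ} (hz : z.im ≠ 0) (hw : w.im ≠ 0)
    (φ : LineL2 (-1)) :
    (z - w) • ContinuousLinearMap.adjoint (opG hm (conj_im_ne_zero hw)) (opG hm hz φ) =
      ((imSign z - imSign w) * (I * m / 2) : ℂ) • φ := by
  have hsw := (Measure.measurePreserving_swap (μ := (volume : Measure ℝ))
      (ν := (volume : Measure ℝ))).quasiMeasurePreserving.ae (opG_coeFn hm hz φ)
  have hsl : ∀ᵐ p : ℝ, ∀ᵐ q : ℝ, opG hm hz φ (q, p) = green m z (q, p) * φ p :=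
    Measure.ae_ae_of_ae_prod hsw
  refine Lp.ext ?_
  filter_upwards [Lp.coeFn_smul (z - w)
      (ContinuousLinearMap.adjoint (opG hm (conj_im_ne_zero hw)) (opG hm hz φ)),
    Lp.coeFn_smul ((imSign z - imSign w) * (I * m / 2) : ℂ) φ,
    adjoint_opG_coeFn hm (conj_im_ne_zero hw) (opG hm hz φ),
    (ae_absMeasure_iff (-1)).2 hsl, (ae_absMeasure_iff (-1)).2 ae_ne_zero_real] with p h1 h2 h3 h4 hp
  rw [h1, h2, Pi.smul_apply, Pi.smul_apply, h3, smul_eq_mul, smul_eq_mul,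
    ← integral_green_mul_green hm hz hw hp]
  have e : ∫ q, conj (green m (conj w) (q, p)) * opG hm hz φ (q, p) =
      (∫ q, conj (green m (conj w) (q, p)) * green m z (q, p)) * φ p := by
    rw [← integral_mul_const]
    refine integral_congr_ae ?_
    filter_upwards [h4] with q hq
    rw [hq, mul_assoc]
  rw [e]
  ring

/-- For `u = R⁰_{w̄} v`, the pairings of `G_z φ` with `(L₀ - z̄) u` and of `G_w φ` with `(L₀ - w̄) u
= v` coincide by `inner_opG`; their comparison is the identity tested against `v`. -/
theorem opG_sub_opG {m : ℝ} (hm : 0 < m) {z w : ℂ} (hz : z.im ≠ 0) (hw : w.im ≠ 0)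
    (φ : LineL2 (-1)) :
    opG hm hz φ - opG hm hw φ = (z - w) • freeResolvent m w (opG hm hz φ) := by
  refine ext_inner_right ℂ fun v => ?_
  obtain ⟨hu, e⟩ := (isResolvent_freeResolvent m (conj_im_ne_zero hw)).1 v
  have h1 := inner_opG hm hz φ ⟨_, hu⟩
  have h2 := inner_opG hm hw φ ⟨_, hu⟩
  rw [← h1, e] at h2
  have e' : freeOp m ⟨_, hu⟩ = v + conj w • freeResolvent m (conj w) v :=
    sub_eq_iff_eq_add.1 e
  rw [e'] at h2
  rw [inner_sub_left, h2, inner_smul_left, inner_freeResolvent m hw, inner_sub_right,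
    inner_add_right, inner_smul_right, inner_smul_right, map_sub]
  ring

theorem adjoint_opG_sub {m : ℝ} (hm : 0 < m) {z w : ℂ} (hz : z.im ≠ 0) (hw : w.im ≠ 0)
    (f : PhaseL2) :
    (z - w) • ContinuousLinearMap.adjoint (opG hm (conj_im_ne_zero hw)) (freeResolvent m z f) =
      ContinuousLinearMap.adjoint (opG hm (conj_im_ne_zero hz)) f -
        ContinuousLinearMap.adjoint (opG hm (conj_im_ne_zero hw)) f := by
  refine ext_inner_left ℂ fun φ => ?_
  have h := congrArg (fun g => inner ℂ g f)
    (opG_sub_opG hm (conj_im_ne_zero hw) (conj_im_ne_zero hz) φ)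
  simp only [inner_sub_left, inner_smul_left, inner_freeResolvent m (conj_im_ne_zero hz),
    conj_conj, map_sub] at h
  simp only [inner_smul_right, inner_sub_right, ContinuousLinearMap.adjoint_inner_right]
  linear_combination h

/-- For `w = z̄` the scalar in `adjoint_opG_opG` is `±i m`, which is nonzero. -/
theorem opG_injective {m : ℝ} (hm : 0 < m) {z : ℂ} (hz : z.im ≠ 0) {φ : LineL2 (-1)}
    (h : opG hm hz φ = 0) : φ = 0 := by
  have h1 := adjoint_opG_opG hm hz (conj_im_ne_zero hz) φ
  rw [h, map_zero, smul_zero, eq_comm, smul_eq_zero, imSign_conj] at h1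
  refine h1.resolve_left ?_
  have hmc : (m : ℂ) ≠ 0 := by exact_mod_cast hm.ne'
  rcases imSign_eq_one_or hz with h | h <;> rw [h] <;> norm_num [hmc]

/-- The range of `G_z` intersects the domain of `L₀` trivially. -/
theorem eq_zero_of_opG_mem_domain {m : ℝ} (hm : 0 < m) {z : ℂ} (hz : z.im ≠ 0)
    {φ : LineL2 (-1)} (h : opG hm hz φ ∈ (freeOp m).domain) : φ = 0 := by
  -- By symmetry of `L₀` and `inner_opG`, `(L₀ - z) G_z φ` is orthogonal to the dense subspace `ker
  -- γ`. Hence `G_z φ` is in the kernel of `L₀ - z`, which is trivial.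
  have key : freeOp m ⟨_, h⟩ - z • opG hm hz φ = 0 := by
    refine (dense_freeOpKer_domain hm).eq_zero_of_inner_left ℂ fun u hu' => ?_
    obtain ⟨hu, h0⟩ := mem_freeOpKer_domain_iff.1 hu'
    have h1 := inner_opG hm hz φ ⟨u, hu⟩
    have h2 := freeOp_isFormalAdjoint m ⟨_, h⟩ ⟨u, hu⟩
    have h3 : ∫ p : ℝ, conj (φ p) * (0 : LineL2 1) p = 0 := by
      refine integral_eq_zero_of_ae ?_
      filter_upwards [(ae_absMeasure_iff 1).1 (Lp.coeFn_zero ℂ 2 (absMeasure 1))] with p hp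
      rw [hp]
      simp
    rw [h0, h3, inner_sub_right, inner_smul_right] at h1
    rw [inner_sub_left, inner_smul_left, h2]
    exact h1
  have h1 := (isResolvent_freeResolvent m hz).2 ⟨_, h⟩
  rw [key, map_zero] at h1
  exact opG_injective hm hz h1.symm

end GreenOperators

/-! ### The projector on odd functions -/

section OddProjection

/-- The reflection `f ↦ f(-·)`. -/
def reflect (n : ℤ) : LineL2 n →ₗᵢ[ℂ] LineL2 n :=
  Lp.compMeasurePreservingₗᵢ ℂ (fun p : ℝ => -p) (measurePreserving_neg_absMeasure n)

theorem reflect_coeFn (n : ℤ) (f : LineL2 n) : reflect n f =ᵐ[absMeasure n] fun p => f (-p) :=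
  Lp.coeFn_compMeasurePreserving f (measurePreserving_neg_absMeasure n)

theorem reflect_reflect (n : ℤ) (f : LineL2 n) : reflect n (reflect n f) = f := by
  refine Lp.ext ?_
  filter_upwards [reflect_coeFn n (reflect n f),
    (measurePreserving_neg_absMeasure n).quasiMeasurePreserving.ae (reflect_coeFn n f)]
    with p h1 h2
  rw [h1, h2, neg_neg]

theorem oddProj_apply (n : ℤ) (f : LineL2 n) :
    oddProj n f = (1 / 2 : ℂ) • (f - reflect n f) := rfl

theorem oddProj_oddProj (n : ℤ) (f : LineL2 n) : oddProj n (oddProj n f) = oddProj n f := by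
  simp only [oddProj_apply, map_smul, map_sub, reflect_reflect]
  module

theorem inner_oddProj (n : ℤ) (f g : LineL2 n) :
    inner ℂ (oddProj n f) g = inner ℂ f (oddProj n g) := by
  have h : inner ℂ (reflect n f) g = inner ℂ f (reflect n g) := by
    conv_lhs => rw [← reflect_reflect n g]
    exact (reflect n).inner_map_map f _
  rw [oddProj_apply, oddProj_apply, inner_smul_left, inner_smul_right, inner_sub_left,
    inner_sub_right, h, map_div₀, map_one, map_ofNat]

/-- Multiplication by an even function commutes with the projector on odd functions. -/
theorem oddProj_weightedComp {n n' : ℤ} {k : ℝ → ℂ} {C : ℝ≥0}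
    (h : WeightBound (absMeasure n) (absMeasure n') id k C) (hk : Measurable k)
    (heven : ∀ p, k (-p) = k p) (f : LineL2 n) :
    oddProj n' (weightedComp h measurable_id hk f) =
      weightedComp h measurable_id hk (oddProj n f) := by
  have hr : reflect n' (weightedComp h measurable_id hk f) =
      weightedComp h measurable_id hk (reflect n f) := by
    refine Lp.ext ?_
    filter_upwards [reflect_coeFn n' (weightedComp h measurable_id hk f),
      (measurePreserving_neg_absMeasure n').quasiMeasurePreserving.ae
        (weightedComp_coeFn h measurable_id hk f),
      weightedComp_coeFn h measurable_id hk (reflect n f),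
      (ae_absMeasure_iff n').2 ((ae_absMeasure_iff n).1 (reflect_coeFn n f))] with p h1 h2 h3 h4
    rw [h1, h2, h3, id, id, h4, heven]
  rw [oddProj_apply, oddProj_apply, hr, map_smul, map_sub]

end OddProjection

/-! ### The boundary operator `Π' Λ_z Π' |p|⁻¹` -/

section BoundaryOperator

theorem coupling_neg (b : OnePoint ℝ) (p : ℝ) : coupling b (-p) = coupling b p := by
  simp [coupling]

theorem symbolΛ_neg (m : ℝ) (b : OnePoint ℝ) (z : ℂ) (p : ℝ) :
    symbolΛ m b z (-p) = symbolΛ m b z p := by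
  simp only [symbolΛ, coupling_neg, abs_neg]

theorem symbolΛ_eq (m : ℝ) (b : OnePoint ℝ) (z : ℂ) (p : ℝ) :
    symbolΛ m b z p = ((recip (coupling b p) : ℂ) - imSign z * (I * m / (2 * (|p| : ℝ))))⁻¹ := by
  rw [symbolΛ, coe_imSign, one_div]

/-- For real `r` the imaginary part is `∓m / (2 |p|)`, which never vanishes. -/
theorem symbolΛ_denom_ne_zero {m : ℝ} (hm : 0 < m) {z : ℂ} (hz : z.im ≠ 0) (r : ℝ) {p : ℝ}
    (hp : p ≠ 0) : (r : ℂ) - imSign z * (I * m / (2 * (|p| : ℝ))) ≠ 0 := by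
  intro h
  have hp' : 0 < |p| := abs_pos.2 hp
  have e : (r : ℂ) - imSign z * (I * m / (2 * (|p| : ℝ))) =
      (r : ℂ) + ((-(imSign z * (m / (2 * |p|))) : ℝ) : ℂ) * I := by
    push_cast; ring
  rw [e] at h
  have him := congrArg Complex.im h
  have : 0 < m / (2 * |p|) := by positivity
  simp only [add_im, ofReal_im, mul_im, ofReal_re, I_im, I_re, zero_im, mul_one, mul_zero,
    add_zero, zero_add] at him
  rcases imSign_eq_one_or hz with h1 | h1 <;> rw [h1] at him <;> linarith

theorem conj_symbolΛ (m : ℝ) (b : OnePoint ℝ) (z : ℂ) (p : ℝ) :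
    conj (symbolΛ m b z p) = symbolΛ m b (conj z) p := by
  simp only [symbolΛ_eq, map_inv₀, map_sub, map_mul, map_div₀, conj_ofReal, conj_I, imSign_conj,
    map_ofNat]
  congr 1
  push_cast
  ring

/-- With `D_z`, `D_w` the two denominators, `1/D_z - 1/D_w = (D_w - D_z) / (D_z D_w)`. The term
`1/B` cancels in `D_w - D_z`, and `|p| (D_w - D_z)` is exactly the scalar of `adjoint_opG_opG`. -/
theorem symbolΛ_identity {m : ℝ} (hm : 0 < m) (b : OnePoint ℝ) {z w : ℂ} (hz : z.im ≠ 0)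
    (hw : w.im ≠ 0) {p : ℝ} (hp : p ≠ 0) :
    ((imSign z - imSign w) * (I * m / 2) : ℂ) *
      (symbolΛ m b w p * (((|p|)⁻¹ : ℝ) * (symbolΛ m b z p * ((|p|)⁻¹ : ℝ)))) =
      symbolΛ m b z p * ((|p|)⁻¹ : ℝ) - symbolΛ m b w p * ((|p|)⁻¹ : ℝ) := by
  have h1 := symbolΛ_denom_ne_zero hm hz (recip (coupling b p)) hp
  have h2 := symbolΛ_denom_ne_zero hm hw (recip (coupling b p)) hp
  have hpc : ((|p| : ℝ) : ℂ) ≠ 0 := by simpa using hp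
  rw [symbolΛ_eq, symbolΛ_eq]
  generalize hD1 : (recip (coupling b p) : ℂ) - imSign z * (I * m / (2 * (|p| : ℝ))) = D1 at h1 ⊢
  generalize hD2 : (recip (coupling b p) : ℂ) - imSign w * (I * m / (2 * (|p| : ℝ))) = D2 at h2 ⊢
  have h3 : ((imSign z - imSign w) * (I * m / 2) : ℂ) = (D2 - D1) * (|p| : ℝ) := by
    rw [← hD1, ← hD2]
    field_simp
    ring
  rw [h3]
  push_cast
  field_simp

/-- The operator `Π' Λ^B_z Π' |p|⁻¹` in `L²(ℝ, |p|⁻¹dp)`. -/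
def boundaryOp {m : ℝ} (hm : 0 < m) (b : OnePoint ℝ) {z : ℂ} (hz : z.im ≠ 0) :
    LineL2 (-1) →L[ℂ] LineL2 (-1) :=
  oddProj (-1) ∘L opΛ hm b hz ∘L oddProj 1 ∘L
    weightedComp weightBound_invAbs measurable_id measurable_invAbs

theorem oddProj_opΛ {m : ℝ} (hm : 0 < m) (b : OnePoint ℝ) {z : ℂ} (hz : z.im ≠ 0) (φ : LineL2 1) :
    oddProj (-1) (opΛ hm b hz φ) = opΛ hm b hz (oddProj 1 φ) :=
  oddProj_weightedComp _ _ (symbolΛ_neg m b z) φ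

/-- The operator `Λ^B_z |p|⁻¹` in `L²(ℝ, |p|⁻¹dp)`. -/
def symbolOp {m : ℝ} (hm : 0 < m) (b : OnePoint ℝ) {z : ℂ} (hz : z.im ≠ 0) :
    LineL2 (-1) →L[ℂ] LineL2 (-1) :=
  opΛ hm b hz ∘L weightedComp weightBound_invAbs measurable_id measurable_invAbs

theorem symbolOp_coeFn {m : ℝ} (hm : 0 < m) (b : OnePoint ℝ) {z : ℂ} (hz : z.im ≠ 0)
    (φ : LineL2 (-1)) : ∀ᵐ p : ℝ,
    symbolOp hm b hz φ p = symbolΛ m b z p * ((|p|)⁻¹ : ℝ) * φ p := by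
  filter_upwards [(ae_absMeasure_iff (-1)).1 (weightedComp_coeFn (weightBound_symbolΛ hm b hz)
      measurable_id (measurable_symbolΛ m b z)
      (weightedComp weightBound_invAbs measurable_id measurable_invAbs φ)),
    (ae_absMeasure_iff 1).1
      (weightedComp_coeFn weightBound_invAbs measurable_id measurable_invAbs φ)] with p h1 h2
  rw [symbolOp, ContinuousLinearMap.comp_apply, opΛ, h1, id, h2, id, mul_assoc]

/-- All multipliers are even, so one projector suffices and may stand on either side; the form with
it on the right and the one on the left serve the adjoint and the product. -/
theorem boundaryOp_apply {m : ℝ} (hm : 0 < m) (b : OnePoint ℝ) {z : ℂ} (hz : z.im ≠ 0)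
    (φ : LineL2 (-1)) : boundaryOp hm b hz φ = symbolOp hm b hz (oddProj (-1) φ) := by
  simp only [boundaryOp, symbolOp, ContinuousLinearMap.comp_apply]
  rw [oddProj_opΛ, oddProj_oddProj, oddProj_weightedComp _ _ fun p => by simp]

theorem boundaryOp_apply_left {m : ℝ} (hm : 0 < m) (b : OnePoint ℝ) {z : ℂ} (hz : z.im ≠ 0)
    (φ : LineL2 (-1)) : boundaryOp hm b hz φ = oddProj (-1) (symbolOp hm b hz φ) := by
  simp only [boundaryOp, symbolOp, ContinuousLinearMap.comp_apply]
  rw [oddProj_opΛ, oddProj_opΛ, oddProj_oddProj]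

theorem inner_boundaryOp {m : ℝ} (hm : 0 < m) (b : OnePoint ℝ) {z : ℂ} (hz : z.im ≠ 0)
    (φ ψ : LineL2 (-1)) : inner ℂ (boundaryOp hm b hz φ) ψ =
      inner ℂ φ (boundaryOp hm b (conj_im_ne_zero hz) ψ) := by
  rw [boundaryOp_apply, boundaryOp_apply_left, ← inner_oddProj, L2.inner_def, L2.inner_def]
  refine integral_congr_ae ?_
  filter_upwards [(ae_absMeasure_iff (-1)).2 (symbolOp_coeFn hm b hz (oddProj (-1) φ)),
    (ae_absMeasure_iff (-1)).2 (symbolOp_coeFn hm b (conj_im_ne_zero hz) ψ)] with p h1 h2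
  rw [h1, h2]
  simp only [RCLike.inner_apply, map_mul, conj_symbolΛ, conj_ofReal]
  ring

/-- Once the projectors are collected on `φ`, this is `symbolΛ_identity` pointwise in `p`. -/
theorem boundaryOp_identity {m : ℝ} (hm : 0 < m) (b : OnePoint ℝ) {z w : ℂ} (hz : z.im ≠ 0)
    (hw : w.im ≠ 0) (φ : LineL2 (-1)) :
    ((imSign z - imSign w) * (I * m / 2) : ℂ) • boundaryOp hm b hw (boundaryOp hm b hz φ) =
      boundaryOp hm b hz φ - boundaryOp hm b hw φ := by
  rw [boundaryOp_apply hm b hw (boundaryOp hm b hz φ), boundaryOp_apply_left hm b hz,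
    oddProj_oddProj, ← boundaryOp_apply_left hm b hz, boundaryOp_apply hm b hz,
    boundaryOp_apply hm b hw]
  generalize oddProj (-1) φ = ψ
  refine Lp.ext ?_
  filter_upwards [Lp.coeFn_smul ((imSign z - imSign w) * (I * m / 2) : ℂ)
      (symbolOp hm b hw (symbolOp hm b hz ψ)),
    Lp.coeFn_sub (symbolOp hm b hz ψ) (symbolOp hm b hw ψ),
    (ae_absMeasure_iff (-1)).2 (symbolOp_coeFn hm b hw (symbolOp hm b hz ψ)),
    (ae_absMeasure_iff (-1)).2 (symbolOp_coeFn hm b hz ψ),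
    (ae_absMeasure_iff (-1)).2 (symbolOp_coeFn hm b hw ψ),
    (ae_absMeasure_iff (-1)).2 ae_ne_zero_real] with p h1 h2 h3 h4 h5 hp
  rw [h1, h2, Pi.smul_apply, Pi.sub_apply, h3, h4, h5, smul_eq_mul]
  linear_combination ψ p * symbolΛ_identity hm b hz hw hp

end BoundaryOperator

/-! ### Krein's formula and the extension `L_B` -/

section Krein

theorem kreinResolvent_apply {m : ℝ} (hm : 0 < m) (b : OnePoint ℝ) {z : ℂ} (hz : z.im ≠ 0)
    (f : PhaseL2) : kreinResolvent hm b hz f = freeResolvent m z f + opG hm hz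
      (boundaryOp hm b hz (ContinuousLinearMap.adjoint (opG hm (conj_im_ne_zero hz)) f)) := rfl

theorem freeResolvent_sub {m : ℝ} {z w : ℂ} (hz : z.im ≠ 0) (hw : w.im ≠ 0) (f : PhaseL2) :
    freeResolvent m z f - freeResolvent m w f =
      (z - w) • freeResolvent m w (freeResolvent m z f) := by
  obtain ⟨hu, e⟩ := (isResolvent_freeResolvent m hz).1 f
  have h := (isResolvent_freeResolvent m hw).2 ⟨_, hu⟩
  have e' : freeOp m ⟨_, hu⟩ = f + z • freeResolvent m z f := sub_eq_iff_eq_add.1 e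
  rw [e', map_sub, map_add, map_smul, map_smul] at h
  change _ = freeResolvent m z f at h
  nth_rewrite 1 [← h]
  module

/-- The product `(z - w) R^B_w R^B_z` has four terms. With `a = G_{z̄}† f` and `ψ = M_z a` they
equal `R⁰_z f - R⁰_w f`, `G_z ψ - G_w ψ`, `G_w M_w (a - G_{w̄}† f)` and `G_w (ψ - M_w a)`, and the
sum telescopes. -/
theorem kreinResolvent_sub {m : ℝ} (hm : 0 < m) (b : OnePoint ℝ) {z w : ℂ} (hz : z.im ≠ 0)
    (hw : w.im ≠ 0) (f : PhaseL2) :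
    kreinResolvent hm b hz f - kreinResolvent hm b hw f =
      (z - w) • kreinResolvent hm b hw (kreinResolvent hm b hz f) := by
  simp only [kreinResolvent_apply, map_add, smul_add]
  set a := ContinuousLinearMap.adjoint (opG hm (conj_im_ne_zero hz)) f with ha
  set ψ := boundaryOp hm b hz a with hψ
  have h1 := freeResolvent_sub (m := m) hz hw f
  have h2 := opG_sub_opG hm hz hw ψ
  have h3 := congrArg (fun x => opG hm hw (boundaryOp hm b hw x)) (adjoint_opG_sub hm hz hw f)
  have h4 := congrArg (fun x => opG hm hw (boundaryOp hm b hw x)) (adjoint_opG_opG hm hz hw ψ)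
  have h5 := congrArg (opG hm hw) (boundaryOp_identity hm b hz hw a)
  simp only [map_smul, map_sub] at h3 h4 h5
  rw [← ha] at h3
  rw [← hψ] at h5
  rw [← h1, ← h2, h3, h4, h5]
  abel

/-- If `R^B_z f = 0`, then `G_z ψ = -R⁰_z f` lies in `dom L₀`, so both terms vanish, and `R⁰_z` is
injective. -/
theorem kreinResolvent_injective {m : ℝ} (hm : 0 < m) (b : OnePoint ℝ) {z : ℂ} (hz : z.im ≠ 0)
    (f : PhaseL2) (h : kreinResolvent hm b hz f = 0) : f = 0 := by
  rw [kreinResolvent_apply] at h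
  set ψ := boundaryOp hm b hz (ContinuousLinearMap.adjoint (opG hm (conj_im_ne_zero hz)) f)
  obtain ⟨hu, e⟩ := (isResolvent_freeResolvent m hz).1 f
  have h1 : opG hm hz ψ = -freeResolvent m z f := eq_neg_of_add_eq_zero_right h
  have h2 : ψ = 0 := eq_zero_of_opG_mem_domain hm hz (h1 ▸ neg_mem hu)
  rw [h2, map_zero, add_zero] at h
  have h3 : (⟨freeResolvent m z f, hu⟩ : (freeOp m).domain) = 0 := Subtype.ext h
  rw [h3, h, LinearPMap.map_zero, smul_zero, sub_zero] at e
  exact e.symm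

theorem inner_kreinResolvent {m : ℝ} (hm : 0 < m) (b : OnePoint ℝ) {z : ℂ} (hz : z.im ≠ 0)
    (f g : PhaseL2) : inner ℂ (kreinResolvent hm b hz f) g =
      inner ℂ f (kreinResolvent hm b (conj_im_ne_zero hz) g) := by
  rw [kreinResolvent_apply, kreinResolvent_apply, inner_add_left, inner_add_right,
    inner_freeResolvent m hz,
    opG_congr hm (conj_conj z) (conj_im_ne_zero (conj_im_ne_zero hz)) hz,
    ← ContinuousLinearMap.adjoint_inner_right (opG hm hz), inner_boundaryOp,
    ContinuousLinearMap.adjoint_inner_left]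

/-- The bridge from the resolvent to the description of the domain: `G_{z̄}^* (L₀ - z) u = γ u`, and
the two projectors merge into one. -/
theorem kreinResolvent_freeOp {m : ℝ} (hm : 0 < m) (b : OnePoint ℝ) {z : ℂ} (hz : z.im ≠ 0)
    (u : (freeOp m).domain) : kreinResolvent hm b hz (freeOp m u - z • (u : PhaseL2)) =
      u + opG hm hz (opΛ hm b hz (oddProj 1 (traceMap m u))) := by
  have h := traceMap_eq hm (conj_im_ne_zero hz) u
  rw [conj_conj] at h
  rw [h]
  change freeResolvent m z _ + opG hm hz (oddProj (-1) (opΛ hm b hz (oddProj 1 (dualAdjoint _ _))))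
    = _
  rw [(isResolvent_freeResolvent m hz).2 u, oddProj_opΛ, oddProj_oddProj]

/-- The extension of `L₀ ↾ ker γ` defined by the resolvents `R^B_z`. -/
theorem exists_isResolvent_kreinResolvent {m : ℝ} (hm : 0 < m) (b : OnePoint ℝ) :
    ∃ LB : PhaseL2 →ₗ.[ℂ] PhaseL2,
      ∀ (z : ℂ) (hz : z.im ≠ 0), IsResolvent LB z (kreinResolvent hm b hz) :=
  exists_isResolvent_of_resolventIdentity (fun _ hz => kreinResolvent hm b hz)
    (fun _ hz f h => kreinResolvent_injective hm b hz f h)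
    (fun _ _ hz hw f => kreinResolvent_sub hm b hz hw f)

/-- The domain is the range of `R^B_z`, and every vector of `L²` has the form `(L₀ - z) u`. -/
theorem mem_domain_iff_of_isResolvent {m : ℝ} (hm : 0 < m) (b : OnePoint ℝ) {z : ℂ}
    (hz : z.im ≠ 0) {LB : PhaseL2 →ₗ.[ℂ] PhaseL2}
    (h : IsResolvent LB z (kreinResolvent hm b hz)) (f : PhaseL2) :
    f ∈ LB.domain ↔ ∃ u : (freeOp m).domain,
      f = u + opG hm hz (opΛ hm b hz (oddProj 1 (traceMap m u))) := by
  constructor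
  · intro hf
    have h1 := h.2 ⟨f, hf⟩
    obtain ⟨hu, e⟩ := (isResolvent_freeResolvent m hz).1 (LB ⟨f, hf⟩ - z • f)
    refine ⟨⟨_, hu⟩, ?_⟩
    rw [← kreinResolvent_freeOp hm b hz, e]
    exact h1.symm
  · rintro ⟨u, rfl⟩
    rw [← kreinResolvent_freeOp hm b hz]
    exact (h.1 _).1

theorem apply_of_isResolvent {m : ℝ} (hm : 0 < m) (b : OnePoint ℝ) {z : ℂ}
    (hz : z.im ≠ 0) {LB : PhaseL2 →ₗ.[ℂ] PhaseL2}
    (h : IsResolvent LB z (kreinResolvent hm b hz)) (f : LB.domain) (u : (freeOp m).domain)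
    (hfu : (f : PhaseL2) = u + opG hm hz (opΛ hm b hz (oddProj 1 (traceMap m u)))) :
    LB f - z • (f : PhaseL2) = freeOp m u - z • (u : PhaseL2) := by
  rw [← kreinResolvent_freeOp hm b hz] at hfu
  obtain ⟨h1, e⟩ := h.1 (freeOp m u - z • (u : PhaseL2))
  have : f = ⟨_, h1⟩ := Subtype.ext hfu
  subst this
  exact e

/-- For `γ u = 0` the correction `G_z Λ_z Π' γ u` vanishes, so `u` is its own regular part. -/
theorem freeOpKer_le_of_isResolvent {m : ℝ} (hm : 0 < m) (b : OnePoint ℝ) {z : ℂ}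
    (hz : z.im ≠ 0) {LB : PhaseL2 →ₗ.[ℂ] PhaseL2}
    (h : IsResolvent LB z (kreinResolvent hm b hz)) : freeOpKer m ≤ LB := by
  have key : ∀ u : (freeOp m).domain, traceMap m u = 0 →
      (u : PhaseL2) = u + opG hm hz (opΛ hm b hz (oddProj 1 (traceMap m u))) := by
    intro u hu
    rw [hu]
    simp
  refine ⟨fun f hf => ?_, fun x y hxy => ?_⟩
  · obtain ⟨hf', h0⟩ := mem_freeOpKer_domain_iff.1 hf
    exact (mem_domain_iff_of_isResolvent hm b hz h f).2 ⟨⟨f, hf'⟩, key _ h0⟩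
  · obtain ⟨hx, h0⟩ := mem_freeOpKer_domain_iff.1 x.2
    have h1 := (freeOpKer_le_freeOp m).2 (x := x) (y := ⟨x, hx⟩) rfl
    have h2 := apply_of_isResolvent hm b hz h y ⟨x, hx⟩ (hxy.symm.trans (key ⟨x, hx⟩ h0))
    rw [h1]
    simp only [hxy, sub_left_inj] at h2 ⊢
    exact h2.symm

end Krein

end DeltaPrime

end

open DeltaPrime MeasureTheory
open scoped ComplexConjugate
theorem theorem2p1 (m : ℝ) (hm : 0 < m) (b : OnePoint ℝ) (hb : b ≠ ((0 : ℝ) : OnePoint ℝ)) :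
    -- the trace map, the free resolvent and `G_z` are what they are meant to be
    (∀ u : (freeOp m).domain, IsTrace (u : PhaseL2) (traceMap m u)) ∧
    (∃ C : ℝ, ∀ u : (freeOp m).domain, ‖traceMap m u‖ ≤ C * (‖(u : PhaseL2)‖ + ‖freeOp m u‖)) ∧
    IsSelfAdjoint (freeOp m) ∧
    (∀ z : ℂ, z.im ≠ 0 → IsResolvent (freeOp m) z (freeResolvent m z)) ∧
    (∀ (z : ℂ) (hz : z.im ≠ 0) (φ : LineL2 (-1)) (u : (freeOp m).domain),
      inner ℂ (opG hm hz φ) (freeOp m u - conj z • (u : PhaseL2)) =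
        ∫ p : ℝ, conj (φ p) * traceMap m u p) ∧
    -- `L₀` restricted to `ker γ` is densely defined, closed and symmetric
    Dense ((freeOpKer m).domain : Set PhaseL2) ∧
    (freeOpKer m).IsClosed ∧
    (freeOpKer m).IsFormalAdjoint (freeOpKer m) ∧
    -- the self-adjoint extension `L_B`
    ∃ LB : PhaseL2 →ₗ.[ℂ] PhaseL2,
      IsSelfAdjoint LB ∧
      freeOpKer m ≤ LB ∧
      ∀ (z : ℂ) (hz : z.im ≠ 0),
        IsResolvent LB z (kreinResolvent hm b hz) ∧
        (∀ f : PhaseL2, f ∈ LB.domain ↔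
          ∃ u : (freeOp m).domain,
            f = u + opG hm hz (opΛ hm b hz (oddProj 1 (traceMap m u)))) ∧
        ∀ (f : LB.domain) (u : (freeOp m).domain),
          (f : PhaseL2) = u + opG hm hz (opΛ hm b hz (oddProj 1 (traceMap m u))) →
            LB f - z • (f : PhaseL2) = freeOp m u - z • (u : PhaseL2) := by
  obtain ⟨LB, hLB⟩ := exists_isResolvent_kreinResolvent hm b
  -- Self-adjointness and the extension property need only one non-real point; `z = i` is used.
  have hI : Complex.I.im ≠ 0 := by simp
  exact ⟨isTrace_traceMap hm, traceMap_bound hm, isSelfAdjoint_freeOp m,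
    fun z hz => isResolvent_freeResolvent m hz, fun z hz => inner_opG hm hz,
    dense_freeOpKer_domain hm, freeOpKer_isClosed hm, freeOpKer_isFormalAdjoint m, LB,
    isSelfAdjoint_of_isResolvent (hLB _ hI) (hLB _ (conj_im_ne_zero hI))
      (inner_kreinResolvent hm b hI),
    freeOpKer_le_of_isResolvent hm b hI (hLB _ hI), fun z hz => ⟨hLB z hz,
      mem_domain_iff_of_isResolvent hm b hz (hLB z hz), apply_of_isResolvent hm b hz (hLB z hz)⟩⟩
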